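/- Let $M$ be a smooth Hausdorff manifold without boundary of finite dimension (for instance of dimension three), let $\Gamma(\mathrm{Sym}^2T^*M)$ denote the smooth symmetric $(0,2)$-tensor fields on $M$, and let $T:\Gamma(\mathrm{Sym}^2T^*M)\to\Gamma(\mathrm{Sym}^2T^*M)$ be an operator (only its values on Riemannian metrics matter). Assume that $T$ is natural: $\varphi^*T[g]=T[\varphi^*g]$ for every diffeomorphism $\varphi:M\to M$ and every smooth Riemannian metric $g$ on $M$. Let $g_0$ be a smooth Riemannian metric on $M$. A self-similar solution of $$\frac{\partial g}{\partial t}=T[g],\qquad g(0)=g_0, \tag{$*$}$$ on a nondegenerate interval $J\ni 0$ is a solution of the form $g(t)=c(t)\varphi_t^*g_0$, $t\in J$, where $c:J\to(0,\infty)$ satisfies $c(0)=1$ and $\varphi_t$, $t\in J$, are diffeomorphisms of $M$ with $\varphi_0=\mathrm{Id}$ such that $(t,p)\mapsto\varphi_t(p)$ is smooth on $J\times M$ (time derivatives at end points belonging to $J$ are one-sided). For a smooth vector field $X$ on $M$ and $\beta\in\mathbb R$, $(M,g_0,X,\beta)$ is a $T$-soliton structure if $$\beta g_0+\mathcal L_Xg_0=T[g_0];$$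 it is steady if $\beta=0$. The metric $g_0$ is a $T$-soliton if such $X$ and $\beta$ exist. 1. If $g(t)=c(t)\varphi_t^*g_0$ is a self-similar solution of $(*)$ on some nondegenerate interval $J\ni0$, then $g_0$ is a $T$-soliton. 2. If $(M,g_0,X,0)$ is a steady $T$-soliton structure and $X$ is complete, then there is a self-similar solution of $(*)$ of the form $g(t)=\varphi_t^*g_0$, defined for all $t\in\mathbb R$. 3. If $T$ is homogeneous of degree $q\in\mathbb R$, that is, $T[cg]=c^qT[g]$ for all $c>0$ and all Riemannian metrics $g$, and $(M,g_0,X,\beta)$ is a $T$-soliton structure with $X$ complete, then there is a self-similar solution $g(t)=c(t)\varphi_t^*g_0$ of $(*)$ on some open interval containing $0$, with $c$ smooth. -/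

import Mathlib

open scoped Manifold ContDiff Topology
open Bundle

noncomputable section

namespace GeometricFlow

/-- Smooth symmetric `(0,2)`-tensor fields on `M`, that is, smooth sections of the bundle
`Sym²(T*M)`. -/
structure SymTensor (E : Type*) [NormedAddCommGroup E] [NormedSpace ℝ E]
    (M : Type*) [TopologicalSpace M] [ChartedSpace E M] [IsManifold 𝓘(ℝ, E) ∞ M] where
  toFun (x : M) : TangentSpace 𝓘(ℝ, E) x →L[ℝ] TangentSpace 𝓘(ℝ, E) x →L[ℝ] ℝ
  symm (x : M) (v w : TangentSpace 𝓘(ℝ, E) x) : toFun x v w = toFun x w v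
  contMDiff : ContMDiff 𝓘(ℝ, E) (𝓘(ℝ, E).prod 𝓘(ℝ, E →L[ℝ] E →L[ℝ] ℝ)) ∞
    (fun x ↦ TotalSpace.mk' (E →L[ℝ] E →L[ℝ] ℝ)
      (E := fun x : M ↦ TangentSpace 𝓘(ℝ, E) x →L[ℝ] TangentSpace 𝓘(ℝ, E) x →L[ℝ] ℝ) x (toFun x))

variable {E : Type*} [NormedAddCommGroup E] [NormedSpace ℝ E]
  {M : Type*} [TopologicalSpace M] [ChartedSpace E M] [IsManifold 𝓘(ℝ, E) ∞ M]

/-- A field of bilinear forms on the tangent spaces, read in the trivialization of the tangent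
bundle around `x₀`. -/
def inCoords (x₀ : M) (B : ∀ x : M, TangentSpace 𝓘(ℝ, E) x →L[ℝ] TangentSpace 𝓘(ℝ, E) x →L[ℝ] ℝ)
    (x : M) : E →L[ℝ] E →L[ℝ] ℝ :=
  ContinuousLinearMap.inCoordinates E (TangentSpace 𝓘(ℝ, E)) (E →L[ℝ] ℝ)
    (fun x : M ↦ TangentSpace 𝓘(ℝ, E) x →L[ℝ] ℝ) x₀ x x₀ x (B x)

theorem inCoords_apply {x₀ x : M}
    (B : ∀ x : M, TangentSpace 𝓘(ℝ, E) x →L[ℝ] TangentSpace 𝓘(ℝ, E) x →L[ℝ] ℝ)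
    (hx : x ∈ (trivializationAt E (TangentSpace 𝓘(ℝ, E)) x₀).baseSet) (u v : E) :
    inCoords x₀ B x u v =
      B x ((trivializationAt E (TangentSpace 𝓘(ℝ, E)) x₀).symm x u)
        ((trivializationAt E (TangentSpace 𝓘(ℝ, E)) x₀).symm x v) := by
  refine (inCoordinates_apply_eq₂ (𝕜 := ℝ) (E₃ := Trivial M ℝ) (F₃ := ℝ) (ϕ := B x) hx hx
    (Set.mem_univ _)).trans ?_
  simp

theorem eventually_mem_baseSet (x₀ : M) :
    ∀ᶠ x in 𝓝 x₀, x ∈ (trivializationAt E (TangentSpace 𝓘(ℝ, E)) x₀).baseSet :=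
  (trivializationAt E (TangentSpace 𝓘(ℝ, E)) x₀).open_baseSet.mem_nhds
    (FiberBundle.mem_baseSet_trivializationAt' x₀)

theorem contMDiffAt_iff_inCoords
    (B : ∀ x : M, TangentSpace 𝓘(ℝ, E) x →L[ℝ] TangentSpace 𝓘(ℝ, E) x →L[ℝ] ℝ) (x₀ : M) :
    ContMDiffAt 𝓘(ℝ, E) (𝓘(ℝ, E).prod 𝓘(ℝ, E →L[ℝ] E →L[ℝ] ℝ)) ∞
      (fun x ↦ TotalSpace.mk' (E →L[ℝ] E →L[ℝ] ℝ)
        (E := fun x : M ↦ TangentSpace 𝓘(ℝ, E) x →L[ℝ] TangentSpace 𝓘(ℝ, E) x →L[ℝ] ℝ) x (B x)) x₀ ↔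
    ContMDiffAt 𝓘(ℝ, E) 𝓘(ℝ, E →L[ℝ] E →L[ℝ] ℝ) ∞ (inCoords x₀ B) x₀ := by
  rw [contMDiffAt_hom_bundle]
  exact ⟨fun h ↦ h.2, fun h ↦ ⟨contMDiffAt_id, h⟩⟩

namespace SymTensor

/-- A Riemannian metric is a smooth symmetric `(0,2)`-tensor field that is positive definite at
every point. -/
def IsRiemannianMetric (h : SymTensor E M) : Prop :=
  ∀ (x : M) (v : TangentSpace 𝓘(ℝ, E) x), v ≠ 0 → 0 < h.toFun x v v

/-- The tensor field `a h` for a real constant `a`. -/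
instance : SMul ℝ (SymTensor E M) where
  smul a h :=
    { toFun := fun x ↦ a • h.toFun x
      symm := fun x v w ↦ congrArg (fun r : ℝ ↦ a * r) (h.symm x v w)
      contMDiff := by
        intro x₀
        rw [contMDiffAt_iff_inCoords]
        have hH := (contMDiffAt_iff_inCoords _ x₀).1 (h.contMDiff x₀)
        have ha : ContMDiffAt 𝓘(ℝ, E) 𝓘(ℝ, ℝ) ∞ (fun _ : M ↦ a) x₀ := contMDiffAt_const
        refine (ha.smul hH).congr_of_eventuallyEq ?_
        filter_upwards [eventually_mem_baseSet (E := E) x₀] with x hx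
        ext u v
        have e := inCoords_apply h.toFun hx u v
        rw [inCoords_apply _ hx]
        exact congrArg (fun r : ℝ ↦ a * r) e.symm }

/-- The bilinear form `(v, w) ↦ h_{φ x}(dφ_x v, dφ_x w)` on the tangent space at `x`. -/
def pullbackAt (φ : M → M) (h : SymTensor E M) (x : M) :
    TangentSpace 𝓘(ℝ, E) x →L[ℝ] TangentSpace 𝓘(ℝ, E) x →L[ℝ] ℝ :=
  (ContinuousLinearMap.precomp ℝ (mfderiv 𝓘(ℝ, E) 𝓘(ℝ, E) φ x)) ∘L
    (h.toFun (φ x)) ∘L (mfderiv 𝓘(ℝ, E) 𝓘(ℝ, E) φ x)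

theorem pullbackAt_apply (φ : M → M) (h : SymTensor E M) (x : M)
    (v w : TangentSpace 𝓘(ℝ, E) x) :
    pullbackAt φ h x v w =
      h.toFun (φ x) (mfderiv 𝓘(ℝ, E) 𝓘(ℝ, E) φ x v) (mfderiv 𝓘(ℝ, E) 𝓘(ℝ, E) φ x w) := rfl

theorem contMDiff_pullbackAt (φ : M ≃ₘ^∞⟮𝓘(ℝ, E), 𝓘(ℝ, E)⟯ M) (h : SymTensor E M) :
    ContMDiff 𝓘(ℝ, E) (𝓘(ℝ, E).prod 𝓘(ℝ, E →L[ℝ] E →L[ℝ] ℝ)) ∞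
      (fun x ↦ TotalSpace.mk' (E →L[ℝ] E →L[ℝ] ℝ)
        (E := fun x : M ↦ TangentSpace 𝓘(ℝ, E) x →L[ℝ] TangentSpace 𝓘(ℝ, E) x →L[ℝ] ℝ) x
        (pullbackAt φ h x)) := by
  intro x₀
  rw [contMDiffAt_iff_inCoords]
  have hA := ContMDiffAt.mfderiv_const (m := ∞) (φ.contMDiff x₀) (by simp)
  have hH := ((contMDiffAt_iff_inCoords _ (φ x₀)).1 (h.contMDiff (φ x₀))).comp x₀ (φ.contMDiff x₀)
  have hF' : ContDiff ℝ ∞ (ContinuousLinearMap.flipₗᵢ ℝ E E ℝ) := by fun_prop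
  have hF := hF'.contMDiff
  have h1 := hH.clm_comp hA
  have h2 := (hF.contMDiffAt.comp x₀ h1).clm_comp hA
  have h3 := hF.contMDiffAt.comp x₀ h2
  refine h3.congr_of_eventuallyEq ?_
  filter_upwards [eventually_mem_baseSet (E := E) x₀,
    φ.continuous.continuousAt.eventually (eventually_mem_baseSet (E := E) (φ x₀))] with x hx hx'
  ext u v
  rw [inCoords_apply _ hx]
  have hcoord : ∀ u : E, (trivializationAt E (TangentSpace 𝓘(ℝ, E)) (φ x₀)).symm (φ x)
      (inTangentCoordinates 𝓘(ℝ, E) 𝓘(ℝ, E) id φ (mfderiv 𝓘(ℝ, E) 𝓘(ℝ, E) φ) x₀ x u) =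
      mfderiv 𝓘(ℝ, E) 𝓘(ℝ, E) φ x
        ((trivializationAt E (TangentSpace 𝓘(ℝ, E)) x₀).symm x u) := by
    intro u
    have hu : inTangentCoordinates 𝓘(ℝ, E) 𝓘(ℝ, E) id φ (mfderiv 𝓘(ℝ, E) 𝓘(ℝ, E) φ) x₀ x u = _ :=
      DFunLike.congr_fun (ContinuousLinearMap.inCoordinates_eq
        (ϕ := mfderiv 𝓘(ℝ, E) 𝓘(ℝ, E) φ x) hx hx') u
    rw [hu]
    exact (Trivialization.continuousLinearEquivAt ℝ
      (trivializationAt E (TangentSpace 𝓘(ℝ, E)) (φ x₀)) (φ x) hx').symm_apply_apply _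
  have e := inCoords_apply h.toFun hx'
    (inTangentCoordinates 𝓘(ℝ, E) 𝓘(ℝ, E) id φ (mfderiv 𝓘(ℝ, E) 𝓘(ℝ, E) φ) x₀ x u)
    (inTangentCoordinates 𝓘(ℝ, E) 𝓘(ℝ, E) id φ (mfderiv 𝓘(ℝ, E) 𝓘(ℝ, E) φ) x₀ x v)
  rw [hcoord, hcoord] at e
  exact e.symm

/-- The pull-back `φ^* h`, given by `(φ^* h)_x(v, w) = h_{φ x}(dφ_x v, dφ_x w)`. -/
def pullback (φ : M ≃ₘ^∞⟮𝓘(ℝ, E), 𝓘(ℝ, E)⟯ M) (h : SymTensor E M) : SymTensor E M where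
  toFun x := pullbackAt φ h x
  symm x _ _ := h.symm (φ x) _ _
  contMDiff := contMDiff_pullbackAt φ h

end SymTensor

/-- The Lie derivative `L_X h` evaluated on the vector fields `Y`, `Z` at the point `x`:
`(L_X h)(Y, Z) = X(h(Y, Z)) - h([X, Y], Z) - h(Y, [X, Z])`. -/
def lieDerivative (X : ∀ x : M, TangentSpace 𝓘(ℝ, E) x) (h : SymTensor E M)
    (Y Z : ∀ x : M, TangentSpace 𝓘(ℝ, E) x) (x : M) : ℝ :=
  mvfderiv 𝓘(ℝ, E) (fun y ↦ h.toFun y (Y y) (Z y)) x (X x)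
    - h.toFun x (VectorField.mlieBracket 𝓘(ℝ, E) X Y x) (Z x)
    - h.toFun x (Y x) (VectorField.mlieBracket 𝓘(ℝ, E) X Z x)

/-- The vector field `X` is complete: through every point passes an integral curve that is defined
for all times. -/
def IsCompleteField (X : ∀ x : M, TangentSpace 𝓘(ℝ, E) x) : Prop :=
  ∀ x : M, ∃ γ : ℝ → M, γ 0 = x ∧ IsMIntegralCurve (I := 𝓘(ℝ, E)) γ X

/-- `T` is natural: `φ^* T[g] = T[φ^* g]` for all diffeomorphisms `φ` of `M` and all Riemannian
metrics `g`. Here `T` is an operator that takes sections of `Sym²(T*M)` to sections of `Sym²(T*M)`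
(such as the Ricci tensor); its values on sections that are not Riemannian metrics play no role. -/
def IsNatural (T : SymTensor E M → SymTensor E M) : Prop :=
  ∀ (φ : M ≃ₘ^∞⟮𝓘(ℝ, E), 𝓘(ℝ, E)⟯ M) (g : SymTensor E M), g.IsRiemannianMetric →
    SymTensor.pullback φ (T g) = T (SymTensor.pullback φ g)

/-- `T` is homogeneous of degree `q`: `T[c g] = c ^ q T[g]` for all Riemannian metrics `g` and all
scaling factors `c > 0`. -/
def IsHomogeneous (T : SymTensor E M → SymTensor E M) (q : ℝ) : Prop :=
  ∀ g : SymTensor E M, g.IsRiemannianMetric → ∀ c : ℝ, 0 < c → T (c • g) = (c ^ q) • T g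

/-- `(M, g₀, X, β)` is a `T`-soliton structure: `X` is a smooth vector field and
`β g₀ + L_X g₀ = T[g₀]`. The equation between tensor fields is tested at each point `x` on all
vector fields `Y`, `Z` that are smooth at `x`. -/
structure IsSolitonStructure (T : SymTensor E M → SymTensor E M) (g₀ : SymTensor E M)
    (X : ∀ x : M, TangentSpace 𝓘(ℝ, E) x) (β : ℝ) : Prop where
  contMDiff : ContMDiff 𝓘(ℝ, E) 𝓘(ℝ, E).tangent ∞
    (fun x ↦ (⟨x, X x⟩ : TangentBundle 𝓘(ℝ, E) M))
  equation : ∀ (x : M) (Y Z : ∀ x : M, TangentSpace 𝓘(ℝ, E) x),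
    ContMDiffAt 𝓘(ℝ, E) 𝓘(ℝ, E).tangent ∞
      (fun y ↦ (⟨y, Y y⟩ : TangentBundle 𝓘(ℝ, E) M)) x →
    ContMDiffAt 𝓘(ℝ, E) 𝓘(ℝ, E).tangent ∞
      (fun y ↦ (⟨y, Z y⟩ : TangentBundle 𝓘(ℝ, E) M)) x →
    β * g₀.toFun x (Y x) (Z x) + lieDerivative X g₀ Y Z x = (T g₀).toFun x (Y x) (Z x)

/-- `g₀` is a `T`-soliton. -/
def IsSoliton (T : SymTensor E M → SymTensor E M) (g₀ : SymTensor E M) : Prop :=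
  ∃ (X : ∀ x : M, TangentSpace 𝓘(ℝ, E) x) (β : ℝ), IsSolitonStructure T g₀ X β

/-- `g(t) = c(t) φ_t^* g₀`, for `t` in the nondegenerate interval `J` that contains `0`, is a
self-similar solution of `∂g/∂t = T[g]`, `g(0) = g₀`: the `φ_t` are diffeomorphisms of `M` that
depend smoothly on `t`, with `φ_0 = id`, and `c` is a positive function with `c(0) = 1`.
At an end point of `J` that belongs to `J`, the time derivative is one-sided. The values of `c`
and `φ` outside `J` play no role. -/
structure IsSelfSimilarSolution (T : SymTensor E M → SymTensor E M) (g₀ : SymTensor E M)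
    (J : Set ℝ) (c : ℝ → ℝ) (φ : ℝ → M ≃ₘ^∞⟮𝓘(ℝ, E), 𝓘(ℝ, E)⟯ M) : Prop where
  ordConnected : J.OrdConnected
  nontrivial : J.Nontrivial
  zero_mem : (0 : ℝ) ∈ J
  scale_zero : c 0 = 1
  scale_pos : ∀ t ∈ J, 0 < c t
  diffeo_zero : φ 0 = Diffeomorph.refl 𝓘(ℝ, E) M ∞
  diffeo_smooth : ContMDiffOn (𝓘(ℝ, ℝ).prod 𝓘(ℝ, E)) 𝓘(ℝ, E) ∞
    (fun p : ℝ × M ↦ φ p.1 p.2) (J ×ˢ Set.univ)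
  evolution : ∀ t ∈ J, ∀ (x : M) (v w : TangentSpace 𝓘(ℝ, E) x),
    HasDerivWithinAt (fun s ↦ (c s • SymTensor.pullback (φ s) g₀).toFun x v w)
      ((T (c t • SymTensor.pullback (φ t) g₀)).toFun x v w) J t

end GeometricFlow

end

/-! Everything rests on the first variation formula: if `Φ` is a smooth deformation of the identity
with initial velocity `X`, then the derivative of `Φ_s^* g` at `s = 0` is `L_X g`, also when `0` is
an end point of the time interval (`IsDeformation.hasDerivWithinAt_pullbackAt`). In a chart this is
the product rule together with the symmetry of mixed second derivatives.

A self-similar solution, differentiated at time `0`, then gives the soliton equation with `β =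
c'(0)`. Differentiability of `c` is not assumed; it follows by dividing `c(t) φ_t^* g₀` by `φ_t^*
g₀`, both evaluated on one nonzero vector.

Conversely, let `θ` be the flow of `X`. By the group law, `θ_t^* g₀` has derivative `θ_t^* T[g₀] - β
θ_t^* g₀` at every time. For `β = 0`, naturality finishes the argument. In general put `c = exp(β
τ)` and `φ_t = θ_(τ(t))`: the `β` terms cancel and `c τ' θ_τ^* T[g₀]` remains. This equals `T[c
θ_τ^* g₀] = c^q θ_τ^* T[g₀]` once `τ' = exp(-(1 - q) β τ)`, which has an explicit solution.

Joint smoothness of `θ` is proved here: locally by the implicit function theorem for the integral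
equation in a space of continuous curves, where `u ↦ f ∘ u` is smooth
(`ContinuousMap.contDiff_postcomp`), and globally by the group law. -/

/-! ### Smoothness of superposition operators on spaces of continuous functions -/

section SuperpositionOperator

universe u

variable {K : Type*} [TopologicalSpace K] [CompactSpace K]

section Bilinear

variable {E F G : Type*} [NormedAddCommGroup E] [NormedSpace ℝ E] [NormedAddCommGroup F]
  [NormedSpace ℝ F] [NormedAddCommGroup G] [NormedSpace ℝ G]

/-- Pointwise application of a bilinear map to continuous functions. -/
noncomputable def ContinuousMap.pointwiseBilin (B : G →L[ℝ] E →L[ℝ] F) :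
    C(K, G) →L[ℝ] C(K, E) →L[ℝ] C(K, F) :=
  LinearMap.mkContinuous₂
    (LinearMap.mk₂ ℝ (fun (A : C(K, G)) (u : C(K, E)) ↦
        (⟨fun k ↦ B (A k) (u k), by fun_prop⟩ : C(K, F)))
      (fun _ _ _ ↦ by ext; simp) (fun _ _ _ ↦ by ext; simp)
      (fun _ _ _ ↦ by ext; simp) (fun _ _ _ ↦ by ext; simp)) ‖B‖
    (fun A u ↦ by
      refine (ContinuousMap.norm_le _ (by positivity)).2 fun k ↦ ?_
      refine (B.le_opNorm₂ (A k) (u k)).trans ?_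
      gcongr
      exacts [A.norm_coe_le_norm k, u.norm_coe_le_norm k])

/-- The mean value inequality is applied at each `k` on a ball around `u k`. Its radius does not
depend on `k`, because it comes from continuity of `w ↦ f' ∘ w` at `u` in the sup norm. -/
theorem ContinuousMap.hasFDerivAt_postcomp (B : G →L[ℝ] E →L[ℝ] F) {f : E → F} {f' : E → G}
    (hf : ∀ x, HasFDerivAt f (B (f' x)) x) (hc : Continuous f) (hc' : Continuous f') (u : C(K, E)) :
    HasFDerivAt (fun u : C(K, E) ↦ (⟨f, hc⟩ : C(E, F)).comp u)
      (ContinuousMap.pointwiseBilin B ((⟨f', hc'⟩ : C(E, G)).comp u)) u := by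
  rw [hasFDerivAt_iff_isLittleO_nhds_zero, Asymptotics.isLittleO_iff]
  intro ε hε
  have hN : Continuous fun w : C(K, E) ↦ (⟨f', hc'⟩ : C(E, G)).comp w :=
    ContinuousMap.continuous_postcomp _
  obtain ⟨δ, hδ, hb⟩ := Metric.continuousAt_iff.1 (hN.continuousAt (x := u)) (ε / (‖B‖ + 1))
    (by positivity)
  filter_upwards [Metric.ball_mem_nhds (0 : C(K, E)) hδ] with h hh
  rw [mem_ball_zero_iff] at hh
  refine (ContinuousMap.norm_le _ (by positivity)).2 fun k ↦ ?_
  have hbd : ∀ z ∈ Metric.ball (u k) δ, ‖B (f' z) - B (f' (u k))‖ ≤ ε := by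
    intro z hz
    -- Shifting `u` by a constant gives a nearby function whose value at `k` is `z`.
    have h1 : dist (u + ContinuousMap.const K (z - u k)) u < δ := by
      rw [dist_eq_norm, add_sub_cancel_left]
      refine (ContinuousMap.norm_lt_iff _ hδ).2 fun j ↦ ?_
      simpa [dist_eq_norm] using hz
    have h2 : ‖f' z - f' (u k)‖ ≤ ε / (‖B‖ + 1) := by
      simpa [dist_eq_norm] using (ContinuousMap.dist_apply_le_dist k).trans (hb h1).le
    rw [← map_sub]
    calc ‖B (f' z - f' (u k))‖ ≤ ‖B‖ * (ε / (‖B‖ + 1)) := B.le_opNorm_of_le h2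
      _ ≤ (‖B‖ + 1) * (ε / (‖B‖ + 1)) := by gcongr; linarith
      _ = ε := by field_simp
  have hk : ‖h k‖ < δ := (h.norm_coe_le_norm k).trans_lt hh
  have := (convex_ball (u k) δ).norm_image_sub_le_of_norm_hasFDerivWithin_le'
    (f := f) (f' := fun z ↦ B (f' z)) (φ := B (f' (u k))) (C := ε) (x := u k) (y := u k + h k)
    (fun z _ ↦ (hf z).hasFDerivWithinAt) hbd (Metric.mem_ball_self hδ) (by simpa using hk)
  rw [add_sub_cancel_left] at this
  exact this.trans (mul_le_mul_of_nonneg_left (h.norm_coe_le_norm k) hε.le)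

theorem ContinuousMap.contDiff_postcomp_succ {n : ℕ} (B : G →L[ℝ] E →L[ℝ] F) {f : E → F}
    {f' : E → G} (hf : ∀ x, HasFDerivAt f (B (f' x)) x) (hc : Continuous f) (hc' : Continuous f')
    (h : ContDiff ℝ n (fun u : C(K, E) ↦ (⟨f', hc'⟩ : C(E, G)).comp u)) :
    ContDiff ℝ (n + 1) (fun u : C(K, E) ↦ (⟨f, hc⟩ : C(E, F)).comp u) :=
  contDiff_succ_iff_hasFDerivAt.2 ⟨_, (ContinuousMap.pointwiseBilin B).contDiff.comp h,
    ContinuousMap.hasFDerivAt_postcomp B hf hc hc'⟩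

end Bilinear

variable {E F : Type u} [NormedAddCommGroup E] [NormedSpace ℝ E] [NormedAddCommGroup F]
  [NormedSpace ℝ F]

/-- Induction on the order, with the target space varying: the derivative of `f` takes values in `E
→L[ℝ] F`, which stays in the universe shared by `E` and `F`. -/
theorem ContinuousMap.contDiff_postcomp_nat (n : ℕ) {F : Type u} [NormedAddCommGroup F]
    [NormedSpace ℝ F] {f : E → F} (hf : ContDiff ℝ n f) :
    ContDiff ℝ n (fun u : C(K, E) ↦ (⟨f, hf.continuous⟩ : C(E, F)).comp u) := by
  induction n generalizing F with
  | zero => exact contDiff_zero.2 (ContinuousMap.continuous_postcomp _)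
  | succ n ih =>
    push_cast at hf ⊢
    have h1 : ContDiff ℝ (n : WithTop ℕ∞) (fderiv ℝ f) := (contDiff_succ_iff_fderiv.1 hf).2.2
    have hd : ∀ x, HasFDerivAt f (fderiv ℝ f x) x :=
      fun x ↦ ((hf.differentiable (by simp)) x).hasFDerivAt
    exact ContinuousMap.contDiff_postcomp_succ (.id ℝ (E →L[ℝ] F)) hd hf.continuous h1.continuous
      (ih h1)

theorem ContinuousMap.contDiff_postcomp {f : E → F} (hf : ContDiff ℝ ∞ f) :
    ContDiff ℝ ∞ (fun u : C(K, E) ↦ (⟨f, hf.continuous⟩ : C(E, F)).comp u) :=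
  contDiff_infty.2 fun n ↦
    ContinuousMap.contDiff_postcomp_nat n (hf.of_le (by exact_mod_cast le_top))

end SuperpositionOperator

/-! ### Local flows in a Banach space by the implicit function theorem -/

section LocalFlow

open Set

variable {E : Type*} [NormedAddCommGroup E] [NormedSpace ℝ E]

/-- The primitive vanishing at `0` of a continuous function on `[-2, 2]`. -/
noncomputable def ContinuousMap.primitive :
    C(Icc (-2 : ℝ) 2, E) →L[ℝ] C(Icc (-2 : ℝ) 2, E) :=
  LinearMap.mkContinuous
    { toFun := fun u ↦ ⟨fun s ↦ ∫ r in (0 : ℝ)..s, u (projIcc (-2) 2 (by norm_num) r),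
        (intervalIntegral.continuous_primitive
          (f := fun r ↦ u (projIcc (-2) 2 (by norm_num) r)) (fun a b ↦
          Continuous.intervalIntegrable (by fun_prop) a b) 0).comp continuous_subtype_val⟩
      map_add' := fun u v ↦ by
        ext s
        exact intervalIntegral.integral_add (Continuous.intervalIntegrable (by fun_prop) _ _)
          (Continuous.intervalIntegrable (by fun_prop) _ _)
      map_smul' := fun c u ↦ by
        ext s
        exact intervalIntegral.integral_smul c _ } 2
    (fun u ↦ by
      refine (ContinuousMap.norm_le _ (by positivity)).2 fun s ↦ ?_
      refine (intervalIntegral.norm_integral_le_of_norm_le_const (C := ‖u‖)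
        (fun r _ ↦ u.norm_coe_le_norm _)).trans ?_
      rw [mul_comm, sub_zero]
      exact mul_le_mul_of_nonneg_right (abs_le.2 s.2) (norm_nonneg _))

/-- Smooth dependence of solutions of an autonomous differential equation on time and initial
value: for `p = (t, x)` the curve `u p` solves `γ' = t f(γ)`, `γ 0 = x`. -/
theorem exists_contDiffAt_rescaled_flow [CompleteSpace E] {f : E → E} (hf : ContDiff ℝ ∞ f)
    (x₀ : E) :
    ∃ u : ℝ × E → C(Icc (-2 : ℝ) 2, E), ContDiffAt ℝ ∞ u (0, x₀) ∧
      u (0, x₀) = ContinuousMap.const _ x₀ ∧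
      ∀ᶠ p in 𝓝 ((0 : ℝ), x₀), u p (projIcc (-2) 2 (by norm_num) 0) = p.2 ∧
        ∀ s ∈ Ioo (-2 : ℝ) 2, HasDerivAt (fun s ↦ u p (projIcc (-2) 2 (by norm_num) s))
          (p.1 • f (u p (projIcc (-2) 2 (by norm_num) s))) s := by
  let N : C(Icc (-2 : ℝ) 2, E) → C(Icc (-2 : ℝ) 2, E) :=
    fun u ↦ (⟨f, hf.continuous⟩ : C(E, E)).comp u
  have hN : ContDiff ℝ ∞ N := ContinuousMap.contDiff_postcomp hf
  let cst : E →L[ℝ] C(Icc (-2 : ℝ) 2, E) :=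
    LinearMap.mkContinuous
      { toFun := fun x ↦ ContinuousMap.const _ x
        map_add' := fun _ _ ↦ rfl
        map_smul' := fun _ _ ↦ rfl } 1 (fun x ↦ by
          rw [one_mul]; exact (ContinuousMap.norm_le _ (norm_nonneg _)).2 fun _ ↦ le_rfl)
  -- Zeros of `Ψ` are the solutions of `u = x + t ∫ f(u)`. Rescaling turns the time `t` into a
  -- parameter, so all curves live on one interval, with rescaled time `1` in its interior.
  let Ψ : (ℝ × E) × C(Icc (-2 : ℝ) 2, E) → C(Icc (-2 : ℝ) 2, E) := fun p ↦
    p.2 - cst p.1.2 - p.1.1 • ContinuousMap.primitive (N p.2)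
  have hΨ : ContDiff ℝ ∞ Ψ := by fun_prop
  let p₀ : (ℝ × E) × C(Icc (-2 : ℝ) 2, E) := ((0, x₀), cst x₀)
  -- At `t = 0` the integral term disappears, so the partial derivative in `u` is the identity.
  have hinr : fderiv ℝ Ψ p₀ ∘L .inr ℝ (ℝ × E) C(Icc (-2 : ℝ) 2, E) = .id ℝ _ := by
    have h1 : HasFDerivAt (fun u ↦ Ψ ((0, x₀), u))
        (fderiv ℝ Ψ p₀ ∘L .inr ℝ (ℝ × E) C(Icc (-2 : ℝ) 2, E)) (cst x₀) :=
      ((hΨ.differentiable (by simp)) p₀).hasFDerivAt.comp (cst x₀)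
        (hasFDerivAt_prodMk_right (0, x₀) (cst x₀))
    have h2 : HasFDerivAt (fun u ↦ Ψ ((0, x₀), u)) (.id ℝ _) (cst x₀) := by
      simpa [Ψ] using (hasFDerivAt_id (𝕜 := ℝ) (cst x₀)).sub_const (cst x₀)
    exact h1.unique h2
  have hinv : (fderiv ℝ Ψ p₀ ∘L .inr ℝ (ℝ × E) C(Icc (-2 : ℝ) 2, E)).IsInvertible := by
    rw [hinr]; exact ⟨.refl ℝ _, rfl⟩
  have hΨ₀ : ContDiffAt ℝ ∞ Ψ p₀ := hΨ.contDiffAt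
  have hn : (∞ : WithTop ℕ∞) ≠ 0 := by simp
  refine ⟨hΨ₀.implicitFunction hn hinv, hΨ₀.contDiffAt_implicitFunction hn hinv,
    hΨ₀.implicitFunction_apply_self hn hinv, ?_⟩
  filter_upwards [hΨ₀.eventually_apply_implicitFunction hn hinv] with p hp
  set u := hΨ₀.implicitFunction hn hinv p
  have hu : ∀ s, u s = p.2 + p.1 • ∫ r in (0 : ℝ)..s, f (u (projIcc (-2) 2 (by norm_num) r)) := by
    intro s
    have h0 : Ψ p₀ = 0 := by simp [Ψ, p₀]
    have := DFunLike.congr_fun (hp.trans h0) s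
    have h' : u s - p.2 - p.1 •
        ∫ r in (0 : ℝ)..s, f (u (projIcc (-2) 2 (by norm_num) r)) = 0 := this
    rw [sub_sub, sub_eq_zero] at h'
    exact h'
  refine ⟨by rw [hu, projIcc_of_mem _ (by norm_num)]; simp, fun s hs ↦ ?_⟩
  have hcont : Continuous fun r ↦ f (u (projIcc (-2) 2 (by norm_num) r)) :=
    hf.continuous.comp (by fun_prop)
  have hd := ((hcont.integral_hasStrictDerivAt 0 s).hasDerivAt.const_smul p.1).const_add p.2
  refine hd.congr_of_eventuallyEq ?_
  filter_upwards [Ioo_mem_nhds hs.1 hs.2] with r hr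
  rw [hu, projIcc_of_mem _ (Ioo_subset_Icc_self hr)]
  rfl

end LocalFlow

/-! ### Vector fields and bilinear forms read in charts -/

noncomputable section

namespace GeometricFlow

section Charts

variable {E : Type*} [NormedAddCommGroup E] [NormedSpace ℝ E]
  {M : Type*} [TopologicalSpace M] [ChartedSpace E M] [IsManifold 𝓘(ℝ, E) ∞ M]

/-- The derivative at `q` of the chart around `x₀`, with values in the model space. -/
def chartDeriv (x₀ q : M) : TangentSpace 𝓘(ℝ, E) q →L[ℝ] E :=
  mfderiv 𝓘(ℝ, E) 𝓘(ℝ, E) (extChartAt 𝓘(ℝ, E) x₀) q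

/-- A vector field read in the chart around `x₀`. -/
def chartField (x₀ : M) (X : ∀ x : M, TangentSpace 𝓘(ℝ, E) x) (y : E) : E :=
  chartDeriv x₀ ((extChartAt 𝓘(ℝ, E) x₀).symm y) (X ((extChartAt 𝓘(ℝ, E) x₀).symm y))

/-- The dictionary between the trivializations that define smooth sections and the chart derivatives
used for calculus in `E`. -/
theorem trivializationAt_apply_snd {x₀ q : M} (hq : q ∈ (chartAt E x₀).source)
    (v : TangentSpace 𝓘(ℝ, E) q) :
    (trivializationAt E (TangentSpace 𝓘(ℝ, E)) x₀ ⟨q, v⟩).2 = chartDeriv x₀ q v := by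
  have h := TangentBundle.continuousLinearMapAt_trivializationAt (I := 𝓘(ℝ, E)) hq
  have hq' : q ∈ (trivializationAt E (TangentSpace 𝓘(ℝ, E)) x₀).baseSet := by simpa using hq
  have h2 : (trivializationAt E (TangentSpace 𝓘(ℝ, E)) x₀).continuousLinearMapAt ℝ q v =
      chartDeriv x₀ q v := DFunLike.congr_fun h v
  rw [← h2, Trivialization.continuousLinearMapAt_apply, Trivialization.linearMapAt_apply,
    if_pos hq']

theorem apply_eq_inCoords {x₀ q : M} (hq : q ∈ (chartAt E x₀).source)
    (B : ∀ x : M, TangentSpace 𝓘(ℝ, E) x →L[ℝ] TangentSpace 𝓘(ℝ, E) x →L[ℝ] ℝ)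
    (v w : TangentSpace 𝓘(ℝ, E) q) :
    B q v w = inCoords x₀ B q (chartDeriv x₀ q v) (chartDeriv x₀ q w) := by
  have hq' : q ∈ (trivializationAt E (TangentSpace 𝓘(ℝ, E)) x₀).baseSet := by simpa using hq
  rw [inCoords_apply B hq', ← trivializationAt_apply_snd hq, ← trivializationAt_apply_snd hq]
  have key (v : TangentSpace 𝓘(ℝ, E) q) :
      (trivializationAt E (TangentSpace 𝓘(ℝ, E)) x₀).symm q
        (trivializationAt E (TangentSpace 𝓘(ℝ, E)) x₀ ⟨q, v⟩).2 = v :=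
    (trivializationAt E (TangentSpace 𝓘(ℝ, E)) x₀).symm_apply_apply_mk hq' v
  rw [key, key]

theorem contDiffAt_chartField {n : WithTop ℕ∞} (hn : n ≤ ∞) {X : ∀ x : M, TangentSpace 𝓘(ℝ, E) x}
    {x₀ : M} {y : E} (hy : y ∈ (extChartAt 𝓘(ℝ, E) x₀).target)
    (hX : ContMDiffAt 𝓘(ℝ, E) 𝓘(ℝ, E).tangent n
      (fun x ↦ (⟨x, X x⟩ : TangentBundle 𝓘(ℝ, E) M)) ((extChartAt 𝓘(ℝ, E) x₀).symm y)) :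
    ContDiffAt ℝ n (chartField x₀ X) y := by
  have : IsManifold 𝓘(ℝ, E) n M := .of_le hn
  have hs : (extChartAt 𝓘(ℝ, E) x₀).symm y ∈ (chartAt E x₀).source := by
    simpa using (extChartAt 𝓘(ℝ, E) x₀).map_target hy
  have : ContMDiffVectorBundle n E (TangentSpace 𝓘(ℝ, E) : M → Type _) 𝓘(ℝ, E) :=
    ContMDiffVectorBundle.of_le hn
  have h1 := ((trivializationAt E (TangentSpace 𝓘(ℝ, E)) x₀).contMDiffAt_section_iff
    (by simpa using hs)).1 hX
  have h2 : ContMDiffAt 𝓘(ℝ, E) 𝓘(ℝ, E) n (extChartAt 𝓘(ℝ, E) x₀).symm y :=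
    (contMDiffOn_extChartAt_symm x₀).contMDiffAt ((isOpen_extChartAt_target x₀).mem_nhds hy)
  rw [← contMDiffAt_iff_contDiffAt]
  refine (h1.comp y h2).congr_of_eventuallyEq ?_
  filter_upwards [(isOpen_extChartAt_target x₀).mem_nhds hy] with z hz
  have hz' : (extChartAt 𝓘(ℝ, E) x₀).symm z ∈ (chartAt E x₀).source := by
    simpa using (extChartAt 𝓘(ℝ, E) x₀).map_target hz
  exact (trivializationAt_apply_snd hz' _).symm

theorem contMDiffAt_of_contDiffAt_chartField {X : ∀ x : M, TangentSpace 𝓘(ℝ, E) x} {x₀ : M}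
    (hX : ContDiffAt ℝ ∞ (chartField x₀ X) (extChartAt 𝓘(ℝ, E) x₀ x₀)) :
    ContMDiffAt 𝓘(ℝ, E) 𝓘(ℝ, E).tangent ∞
      (fun x ↦ (⟨x, X x⟩ : TangentBundle 𝓘(ℝ, E) M)) x₀ := by
  refine (contMDiffAt_section x₀).2 ?_
  have h := hX.contMDiffAt.comp x₀ (contMDiffAt_extChartAt (I := 𝓘(ℝ, E)) (n := ∞) (x := x₀))
  refine h.congr_of_eventuallyEq ?_
  filter_upwards [(chartAt E x₀).open_source.mem_nhds (mem_chart_source E x₀)] with q hq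
  rw [trivializationAt_apply_snd hq]
  have hq' : (extChartAt 𝓘(ℝ, E) x₀).symm (extChartAt 𝓘(ℝ, E) x₀ q) = q :=
    (extChartAt 𝓘(ℝ, E) x₀).left_inv (by simpa using hq)
  simp only [Function.comp_apply, chartField]
  rw [hq']

/-- A curve in the chart with velocity proportional to a vector field read in the chart is a curve
in the manifold with velocity proportional to the vector field. -/
theorem hasMFDerivAt_extChartAt_symm_comp {X : ∀ x : M, TangentSpace 𝓘(ℝ, E) x} {x₀ : M}
    {γ : ℝ → E} {a s : ℝ} (hs : γ s ∈ (extChartAt 𝓘(ℝ, E) x₀).target)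
    (hγ : HasDerivAt γ (a • chartField x₀ X (γ s)) s) :
    HasMFDerivAt 𝓘(ℝ, ℝ) 𝓘(ℝ, E) (fun r ↦ (extChartAt 𝓘(ℝ, E) x₀).symm (γ r)) s
      ((1 : ℝ →L[ℝ] ℝ).smulRight (a • X ((extChartAt 𝓘(ℝ, E) x₀).symm (γ s)))) := by
  have h1 : MDifferentiableAt 𝓘(ℝ, E) 𝓘(ℝ, E) (extChartAt 𝓘(ℝ, E) x₀).symm (γ s) := by
    simpa [mdifferentiableWithinAt_univ] using
      mdifferentiableWithinAt_extChartAt_symm (I := 𝓘(ℝ, E)) hs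
  have h2 := h1.hasMFDerivAt.comp s hγ.hasFDerivAt.hasMFDerivAt
  have h3 := mfderivWithin_extChartAt_symm_comp_mfderiv_extChartAt (I := 𝓘(ℝ, E)) hs
  rw [modelWithCornersSelf_coe, Set.range_id, mfderivWithin_univ] at h3
  refine h2.congr_mfderiv ?_
  ext
  have h4 := DFunLike.congr_fun h3 (X ((extChartAt 𝓘(ℝ, E) x₀).symm (γ s)))
  have h5 : mfderiv 𝓘(ℝ, E) 𝓘(ℝ, E) (extChartAt 𝓘(ℝ, E) x₀).symm (γ s)
      (a • chartField x₀ X (γ s)) = a • X ((extChartAt 𝓘(ℝ, E) x₀).symm (γ s)) :=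
    (map_smul _ a _).trans (congrArg (a • ·) h4)
  exact (congrArg (mfderiv 𝓘(ℝ, E) 𝓘(ℝ, E) (extChartAt 𝓘(ℝ, E) x₀).symm (γ s))
    (one_smul ℝ (a • chartField x₀ X (γ s)))).trans (h5.trans (one_smul ℝ _).symm)

end Charts

end GeometricFlow
end

/-! ### The flow of a complete vector field -/

noncomputable section

namespace GeometricFlow

section Flow

open Set

variable {E : Type*} [NormedAddCommGroup E] [NormedSpace ℝ E]
  {M : Type*} [TopologicalSpace M] [ChartedSpace E M]
  {X : ∀ x : M, TangentSpace 𝓘(ℝ, E) x} {θ : ℝ → M → M}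

/-- `θ` is the flow of the vector field `X`. -/
structure IsFlow (θ : ℝ → M → M) (X : ∀ x : M, TangentSpace 𝓘(ℝ, E) x) : Prop where
  zero : ∀ x, θ 0 x = x
  integralCurve : ∀ x, IsMIntegralCurve (I := 𝓘(ℝ, E)) (fun t ↦ θ t x) X

theorem IsCompleteField.exists_isFlow (h : IsCompleteField X) : ∃ θ : ℝ → M → M, IsFlow θ X := by
  choose γ h0 h1 using h
  exact ⟨fun t x ↦ γ x t, h0, h1⟩

variable [IsManifold 𝓘(ℝ, E) ∞ M] [T2Space M]

/-- As functions of `s`, both sides are integral curves with the same value at `0`; on a Hausdorff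
manifold such curves coincide. -/
theorem IsFlow.add (hθ : IsFlow θ X)
    (hX : ContMDiff 𝓘(ℝ, E) 𝓘(ℝ, E).tangent ∞ (fun x ↦ (⟨x, X x⟩ : TangentBundle 𝓘(ℝ, E) M)))
    (s t : ℝ) (x : M) : θ (s + t) x = θ s (θ t x) := by
  have h := isMIntegralCurve_Ioo_eq_of_contMDiff_boundaryless (t₀ := 0) (hX.of_le (by simp))
    ((hθ.integralCurve x).comp_add t) (hθ.integralCurve (θ t x)) (by simp [hθ.zero])
  exact congrFun h s

variable [FiniteDimensional ℝ E]

/-- The field, read in a chart and cut off, has a smooth local flow. Near time `0` its curves do not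
leave the region where the cutoff is `1`, and uniqueness of integral curves identifies them with
`θ`. -/
theorem IsFlow.contMDiffAt_zero (hθ : IsFlow θ X)
    (hX : ContMDiff 𝓘(ℝ, E) 𝓘(ℝ, E).tangent ∞ (fun x ↦ (⟨x, X x⟩ : TangentBundle 𝓘(ℝ, E) M)))
    (x₀ : M) :
    ContMDiffAt (𝓘(ℝ, ℝ).prod 𝓘(ℝ, E)) 𝓘(ℝ, E) ∞ (fun p : ℝ × M ↦ θ p.1 p.2) (0, x₀) := by
  set e := extChartAt 𝓘(ℝ, E) x₀
  set y₀ := e x₀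
  obtain ⟨r, hr, hball⟩ := Metric.nhds_basis_closedBall.mem_iff.1
    ((isOpen_extChartAt_target (I := 𝓘(ℝ, E)) x₀).mem_nhds (mem_extChartAt_target x₀))
  let χ : ContDiffBump y₀ := ⟨r / 2, r, by positivity, by linarith⟩
  have hf : ContDiff ℝ ∞ (fun y ↦ χ y • chartField x₀ X y) := by
    rw [contDiff_iff_contDiffAt]
    intro y
    by_cases hy : y ∈ e.target
    · exact χ.contDiffAt.smul (contDiffAt_chartField le_rfl hy (hX _))
    · have hy' : y ∉ tsupport χ := by
        rw [χ.tsupport_eq]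
        exact fun h ↦ hy (hball h)
      refine (contDiffAt_const (c := (0 : E))).congr_of_eventuallyEq ?_
      filter_upwards [notMem_tsupport_iff_eventuallyEq.1 hy'] with z hz
      simp [hz]
  obtain ⟨u, hu, hu0, hsol⟩ := exists_contDiffAt_rescaled_flow hf y₀
  -- At `(0, y₀)` the curve is constant, so continuity in the sup norm confines whole nearby curves
  -- to the inner ball of the bump.
  have hclose : ∀ᶠ p in 𝓝 ((0 : ℝ), y₀), ∀ k, u p k ∈ Metric.ball y₀ (r / 2) := by
    have := hu.continuousAt.eventually (Metric.ball_mem_nhds _ (half_pos hr))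
    filter_upwards [this] with p hp k
    rw [hu0] at hp
    exact (ContinuousMap.dist_apply_le_dist k).trans_lt hp
  have hchart : ContMDiffAt (𝓘(ℝ, ℝ).prod 𝓘(ℝ, E)) 𝓘(ℝ, ℝ × E) ∞
      (fun p : ℝ × M ↦ (p.1, e p.2)) (0, x₀) :=
    contMDiffAt_fst.prodMk_space
      (ContMDiffAt.comp ((0 : ℝ), x₀) (g := e) (contMDiffAt_extChartAt (I := 𝓘(ℝ, E)) (n := ∞)
        (x := x₀)) contMDiffAt_snd)
  let k₁ : Icc (-2 : ℝ) 2 := projIcc (-2) 2 (by norm_num) 1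
  have hout : ContMDiffAt (𝓘(ℝ, ℝ).prod 𝓘(ℝ, E)) 𝓘(ℝ, E) ∞
      (fun p : ℝ × M ↦ e.symm (u (p.1, e p.2) k₁)) (0, x₀) := by
    have h1 : ContDiffAt ℝ ∞ (fun p ↦ u p k₁) (0, y₀) :=
      (ContinuousMap.evalCLM ℝ k₁ : C(Icc (-2 : ℝ) 2, E) →L[ℝ] E).contDiff.contDiffAt.comp _ hu
    have h2 : ContMDiffAt (𝓘(ℝ, ℝ).prod 𝓘(ℝ, E)) 𝓘(ℝ, E) ∞
      (fun p : ℝ × M ↦ u (p.1, e p.2) k₁) (0, x₀) := h1.contMDiffAt.comp ((0 : ℝ), x₀) hchart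
    have h3 : ContMDiffAt 𝓘(ℝ, E) 𝓘(ℝ, E) ∞ e.symm (u (0, y₀) k₁) := by
      rw [hu0]
      exact (contMDiffOn_extChartAt_symm x₀).contMDiffAt
        ((isOpen_extChartAt_target x₀).mem_nhds (mem_extChartAt_target x₀))
    exact h3.comp ((0 : ℝ), x₀) h2
  refine hout.congr_of_eventuallyEq ?_
  have hsrc : ∀ᶠ p in 𝓝 ((0 : ℝ), x₀), p.2 ∈ e.source :=
    continuousAt_snd.eventually (extChartAt_source_mem_nhds x₀)
  filter_upwards [hchart.continuousAt.eventually hsol, hchart.continuousAt.eventually hclose,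
    hsrc] with p hp hpc hps
  obtain ⟨hp0, hpd⟩ := hp
  have hcurve : IsMIntegralCurveOn (I := 𝓘(ℝ, E))
      (fun s ↦ e.symm (u (p.1, e p.2) (projIcc (-2) 2 (by norm_num) s))) (p.1 • X)
      (Ioo (-2) 2) := by
    intro s hs
    have hin := hpc (projIcc (-2) 2 (by norm_num) s)
    have hχ : χ (u (p.1, e p.2) (projIcc (-2) 2 (by norm_num) s)) = 1 :=
      χ.one_of_mem_closedBall (Metric.ball_subset_closedBall hin)
    have hd := hpd s hs
    rw [hχ, one_smul] at hd
    exact (hasMFDerivAt_extChartAt_symm_comp (hball (Metric.closedBall_subset_closedBall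
      (by linarith) (Metric.ball_subset_closedBall hin))) hd).hasMFDerivWithinAt
  have hsmul : ContMDiff 𝓘(ℝ, E) 𝓘(ℝ, E).tangent 1
      (fun x ↦ (⟨x, (p.1 • X) x⟩ : TangentBundle 𝓘(ℝ, E) M)) :=
    ContMDiff.const_smul_section (hX.of_le (by simp))
  -- Both rescaled curves integrate `p.1 • X`; evaluation at `1` then gives the flow at time `p.1`.
  have heq := isMIntegralCurveOn_Ioo_eqOn_of_contMDiff_boundaryless (t₀ := 0) (by norm_num) hsmul
    (((hθ.integralCurve p.2).comp_mul p.1).isMIntegralCurveOn (Ioo (-2) 2)) hcurve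
    (by simp only [Function.comp_apply, zero_mul, hθ.zero]
        rw [hp0]
        exact (e.left_inv hps).symm)
  have := heq (x := 1) (by norm_num)
  simpa using this

/-- For fixed `x₀`, the times `t` at which the flow is smooth near `(t, x₀)` form a nonempty open
and closed subset of `ℝ`. -/
theorem IsFlow.contMDiff (hθ : IsFlow θ X)
    (hX : ContMDiff 𝓘(ℝ, E) 𝓘(ℝ, E).tangent ∞ (fun x ↦ (⟨x, X x⟩ : TangentBundle 𝓘(ℝ, E) M))) :
    ContMDiff (𝓘(ℝ, ℝ).prod 𝓘(ℝ, E)) 𝓘(ℝ, E) ∞ (fun p : ℝ × M ↦ θ p.1 p.2) := by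
  -- The order is made finite because only then does regularity at a point spread to a
  -- neighbourhood.
  rw [contMDiff_infty]
  rintro n ⟨t₁, x₀⟩
  let A : Set ℝ := {t | ContMDiffAt (𝓘(ℝ, ℝ).prod 𝓘(ℝ, E)) 𝓘(ℝ, E) n
    (fun p : ℝ × M ↦ θ p.1 p.2) (t, x₀)}
  have hopen : IsOpen A := by
    rw [isOpen_iff_mem_nhds]
    intro t ht
    have h := (contMDiffAt_iff_contMDiffAt_nhds (by simp)).1 ht
    exact (Continuous.prodMk_left x₀).continuousAt.eventually h
  have hclosed : IsClosed A := by
    rw [← closure_subset_iff_isClosed]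
    intro t ht
    have h := (contMDiffAt_iff_contMDiffAt_nhds (n := n) (by simp)).1
      ((hθ.contMDiffAt_zero hX (θ t x₀)).of_le (by exact_mod_cast le_top))
    -- For `s ∈ A` close to `t`, the point `(t - s, θ s x₀)` lies where the flow is known to be
    -- regular, and `θ r = θ (r - s) ∘ θ s` carries this to `(t, x₀)`.
    have hc : ContinuousAt (fun s ↦ (t - s, θ s x₀)) t :=
      (by fun_prop : ContinuousAt (fun s ↦ t - s) t).prodMk
        (hθ.integralCurve x₀).continuous.continuousAt
    have hev := hc.eventually (by simpa using h)
    obtain ⟨s, hs, hsA⟩ := mem_closure_iff_nhds.1 ht _ hev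
    have hin : ContMDiffAt (𝓘(ℝ, ℝ).prod 𝓘(ℝ, E)) (𝓘(ℝ, ℝ).prod 𝓘(ℝ, E)) n
        (fun p : ℝ × M ↦ (p.1 - s, θ s p.2)) (t, x₀) := by
      refine ContMDiffAt.prodMk ?_ ?_
      · exact (contDiff_id.sub contDiff_const).contMDiff.contMDiffAt.comp _ contMDiffAt_fst
      · exact ContMDiffAt.comp (t, x₀) (g := fun p : ℝ × M ↦ θ p.1 p.2)
          (f := fun p : ℝ × M ↦ (s, p.2)) hsA (contMDiffAt_const.prodMk contMDiffAt_snd)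
    have hs' : ContMDiffAt (𝓘(ℝ, ℝ).prod 𝓘(ℝ, E)) 𝓘(ℝ, E) n
      (fun p : ℝ × M ↦ θ p.1 p.2) (t - s, θ s x₀) := hs
    have hcomp := ContMDiffAt.comp (t, x₀) (g := fun p : ℝ × M ↦ θ p.1 p.2)
      (f := fun p : ℝ × M ↦ (p.1 - s, θ s p.2)) hs' hin
    refine hcomp.congr_of_eventuallyEq (.of_forall fun p ↦ ?_)
    simp [← hθ.add hX]
  have h0 : (0 : ℝ) ∈ A := (hθ.contMDiffAt_zero hX x₀).of_le (by exact_mod_cast le_top)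
  have hA : A = univ := IsClopen.eq_univ ⟨hclosed, hopen⟩ ⟨0, h0⟩
  have ht : t₁ ∈ A := hA ▸ mem_univ t₁
  exact ht

/-- The flow of a complete vector field as a family of diffeomorphisms. -/
def IsFlow.diffeo (hθ : IsFlow θ X)
    (hX : ContMDiff 𝓘(ℝ, E) 𝓘(ℝ, E).tangent ∞ (fun x ↦ (⟨x, X x⟩ : TangentBundle 𝓘(ℝ, E) M)))
    (t : ℝ) : M ≃ₘ^∞⟮𝓘(ℝ, E), 𝓘(ℝ, E)⟯ M where
  toFun := θ t
  invFun := θ (-t)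
  left_inv x := by rw [← hθ.add hX, neg_add_cancel, hθ.zero]
  right_inv x := by rw [← hθ.add hX, add_neg_cancel, hθ.zero]
  contMDiff_toFun := (hθ.contMDiff hX).comp (contMDiff_const.prodMk contMDiff_id)
  contMDiff_invFun := (hθ.contMDiff hX).comp (contMDiff_const.prodMk contMDiff_id)

end Flow

end GeometricFlow
end

/-! ### First variation of a pull-back in coordinates -/

section CoordinateDeformation

open Set

variable {E : Type*} [NormedAddCommGroup E] [NormedSpace ℝ E]

theorem Set.OrdConnected.interior_nonempty_of_nontrivial {K : Set ℝ} (hK : K.OrdConnected)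
    (hK' : K.Nontrivial) : (interior K).Nonempty := by
  obtain ⟨a, ha, b, hb, hab⟩ := hK'.exists_lt
  exact (nonempty_Ioo.2 hab).mono
    (interior_maximal (Ioo_subset_Icc_self.trans (hK.out ha hb)) isOpen_Ioo)

theorem Set.OrdConnected.uniqueDiffOn_of_nontrivial {K : Set ℝ} (hK : K.OrdConnected)
    (hK' : K.Nontrivial) : UniqueDiffOn ℝ K :=
  uniqueDiffOn_convex hK.convex (hK.interior_nonempty_of_nontrivial hK')

variable {K : Set ℝ} {U : Set E} {F : ℝ × E → E} {y₀ : E}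

/-- Since `K` may contain its end points, joint derivatives are taken within `K ×ˢ U`; in the space
direction they are genuine because `U` is open. -/
theorem hasFDerivAt_slice (hU : IsOpen U) (hF : ContDiffOn ℝ ∞ F (K ×ˢ U)) {s : ℝ} (hs : s ∈ K)
    {y : E} (hy : y ∈ U) :
    HasFDerivAt (fun z ↦ F (s, z)) (fderivWithin ℝ F (K ×ˢ U) (s, y) ∘L .inr ℝ ℝ E) y := by
  have h := ((hF.differentiableOn (by simp)) (s, y) ⟨hs, hy⟩).hasFDerivWithinAt
  have h2 := h.comp y (hasFDerivAt_prodMk_right s y).hasFDerivWithinAt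
    (s := U) (fun z hz ↦ ⟨hs, hz⟩)
  exact h2.hasFDerivAt (hU.mem_nhds hy)

theorem hasDerivWithinAt_slice (hF : ContDiffOn ℝ ∞ F (K ×ˢ U)) {s : ℝ} (hs : s ∈ K)
    {y : E} (hy : y ∈ U) :
    HasDerivWithinAt (fun r ↦ F (r, y)) (fderivWithin ℝ F (K ×ˢ U) (s, y) (1, 0)) K s := by
  have h := ((hF.differentiableOn (by simp)) (s, y) ⟨hs, hy⟩).hasFDerivWithinAt
  have h1 : HasDerivWithinAt (fun r : ℝ ↦ (r, y)) ((1 : ℝ), (0 : E)) K s :=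
    (hasDerivWithinAt_id s K).prodMk (hasDerivWithinAt_const s K y)
  exact h.comp_hasDerivWithinAt s h1 (fun r hr ↦ mk_mem_prod hr hy)

/-- The initial velocity field of a smooth deformation of the identity. -/
theorem contDiffOn_velocity (hK : K.OrdConnected) (hK' : K.Nontrivial) (h0 : (0 : ℝ) ∈ K)
    (hU : IsOpen U) (hF : ContDiffOn ℝ ∞ F (K ×ˢ U)) :
    ContDiffOn ℝ ∞ (fun y ↦ fderivWithin ℝ F (K ×ˢ U) (0, y) (1, 0)) U := by
  have hS : UniqueDiffOn ℝ (K ×ˢ U) := (hK.uniqueDiffOn_of_nontrivial hK').prod hU.uniqueDiffOn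
  have hA : ContDiffOn ℝ ∞ (fderivWithin ℝ F (K ×ˢ U)) (K ×ˢ U) :=
    hF.fderivWithin hS (by simp)
  have h1 : ContDiffOn ℝ ∞ (fun y : E ↦ ((0 : ℝ), y)) U := by fun_prop
  exact (hA.comp h1 (fun y hy ↦ ⟨h0, hy⟩)).clm_apply contDiffOn_const

theorem hasFDerivWithinAt_fderivWithin_apply {W : Type*} [NormedAddCommGroup W] [NormedSpace ℝ W]
    {f : W → E} {S : Set W} {p : W} (hS : UniqueDiffOn ℝ S) (hf : ContDiffOn ℝ ∞ f S) (hp : p ∈ S)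
    (a : W) :
    HasFDerivWithinAt (fun q ↦ fderivWithin ℝ f S q a)
      ((fderivWithin ℝ (fderivWithin ℝ f S) S p).flip a) S p := by
  have hA : ContDiffOn ℝ ∞ (fderivWithin ℝ f S) S := hf.fderivWithin hS (by simp)
  have hd := ((hA.differentiableOn (by simp)) p hp).hasFDerivWithinAt
  refine (hd.clm_apply (hasFDerivWithinAt_const a p S)).congr_fderiv ?_
  ext
  simp

/-- Time and space derivatives commute. Symmetry of the second derivative persists at an end point
of `K`, as `(0, y₀)` is in the closure of the interior of `K ×ˢ U`. -/
theorem hasDerivWithinAt_fderivWithin_slice (hK : K.OrdConnected) (hK' : K.Nontrivial)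
    (h0 : (0 : ℝ) ∈ K) (hU : IsOpen U) (hF : ContDiffOn ℝ ∞ F (K ×ˢ U)) (hy₀ : y₀ ∈ U) (v : E) :
    HasDerivWithinAt (fun s ↦ fderivWithin ℝ F (K ×ˢ U) (s, y₀) (0, v))
      (fderiv ℝ (fun y ↦ fderivWithin ℝ F (K ×ˢ U) (0, y) (1, 0)) y₀ v) K 0 := by
  have hS : UniqueDiffOn ℝ (K ×ˢ U) := (hK.uniqueDiffOn_of_nontrivial hK').prod hU.uniqueDiffOn
  have hp : ((0 : ℝ), y₀) ∈ K ×ˢ U := ⟨h0, hy₀⟩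
  have hcl : ((0 : ℝ), y₀) ∈ closure (interior (K ×ˢ U)) := by
    rw [interior_prod_eq, closure_prod_eq, hU.interior_eq,
      (hK.convex : Convex ℝ K).closure_interior_eq_closure_of_nonempty_interior
        (hK.interior_nonempty_of_nontrivial hK')]
    exact ⟨subset_closure h0, subset_closure hy₀⟩
  have hsymm : IsSymmSndFDerivWithinAt ℝ F (K ×ˢ U) (0, y₀) :=
    (hF _ hp).isSymmSndFDerivWithinAt
      (by rw [minSmoothness_of_isRCLikeNormedField]; exact ENat.LEInfty.out) hS hcl hp
  have h1 : HasDerivWithinAt (fun r : ℝ ↦ (r, y₀)) ((1 : ℝ), (0 : E)) K 0 :=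
    (hasDerivWithinAt_id 0 K).prodMk (hasDerivWithinAt_const 0 K y₀)
  have h2 := (hasFDerivWithinAt_fderivWithin_apply hS hF hp (0, v)).comp_hasDerivWithinAt (0 : ℝ) h1
    (fun r hr ↦ mk_mem_prod hr hy₀)
  have h3 := (hasFDerivWithinAt_fderivWithin_apply hS hF hp (1, 0)).comp y₀
    (hasFDerivAt_prodMk_right (0 : ℝ) y₀).hasFDerivWithinAt (s := U) (fun z hz ↦ ⟨h0, hz⟩)
  have h4 : HasFDerivAt (fun y ↦ fderivWithin ℝ F (K ×ˢ U) (0, y) (1, 0)) _ y₀ :=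
    h3.hasFDerivAt (hU.mem_nhds hy₀)
  refine h2.congr_deriv ?_
  rw [h4.fderiv]
  exact hsymm.eq (1, 0) (0, v)

theorem differentiableAt_pairing {W P : Type*} [NormedAddCommGroup W] [NormedSpace ℝ W]
    [NormedAddCommGroup P] [NormedSpace ℝ P] (b : W →L[ℝ] E →L[ℝ] P) (c : P →L[ℝ] E →L[ℝ] ℝ)
    {G : E → W} (hG : DifferentiableAt ℝ G y₀) {Y Z : E → E}
    (hY : DifferentiableAt ℝ Y y₀) (hZ : DifferentiableAt ℝ Z y₀) :
    DifferentiableAt ℝ (fun y ↦ c (b (G y) (Y y)) (Z y)) y₀ :=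
  ((c.differentiableAt.comp y₀ ((b.differentiableAt.comp y₀ hG).clm_apply hY))).clm_apply hZ

/-- The first variation of the pull-back of a field of bilinear forms along a smooth deformation
`F` of the identity is its Lie derivative along the initial velocity `V`. The bilinear forms are
given by a map `G` and the pairing `(v, w) ↦ c (b (G y) v) w`. -/
theorem hasDerivWithinAt_pullback_coord {W P : Type*} [NormedAddCommGroup W] [NormedSpace ℝ W]
    [NormedAddCommGroup P] [NormedSpace ℝ P] (b : W →L[ℝ] E →L[ℝ] P) (c : P →L[ℝ] E →L[ℝ] ℝ)
    (hK : K.OrdConnected) (hK' : K.Nontrivial)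
    (h0 : (0 : ℝ) ∈ K) (hU : IsOpen U) (hF : ContDiffOn ℝ ∞ F (K ×ˢ U)) (hy₀ : y₀ ∈ U)
    (hF0 : ∀ y ∈ U, F (0, y) = y) {G : E → W} (hG : DifferentiableAt ℝ G y₀)
    {V Y Z : E → E} (hV : ∀ y ∈ U, HasDerivWithinAt (fun s ↦ F (s, y)) (V y) K 0)
    (hY : DifferentiableAt ℝ Y y₀) (hZ : DifferentiableAt ℝ Z y₀) :
    HasDerivWithinAt (fun s ↦ c (b (G (F (s, y₀))) (fderiv ℝ (fun z ↦ F (s, z)) y₀ (Y y₀)))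
        (fderiv ℝ (fun z ↦ F (s, z)) y₀ (Z y₀)))
      (fderiv ℝ (fun y ↦ c (b (G y) (Y y)) (Z y)) y₀ (V y₀)
        - c (b (G y₀) (VectorField.lieBracket ℝ V Y y₀)) (Z y₀)
        - c (b (G y₀) (Y y₀)) (VectorField.lieBracket ℝ V Z y₀)) K 0 := by
  have hVeq : ∀ y ∈ U, V y = fderivWithin ℝ F (K ×ˢ U) (0, y) (1, 0) := fun y hy ↦
    (hK.uniqueDiffOn_of_nontrivial hK' 0 h0).eq_deriv _ (hV y hy) (hasDerivWithinAt_slice hF h0 hy)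
  have hVev : V =ᶠ[𝓝 y₀] fun y ↦ fderivWithin ℝ F (K ×ˢ U) (0, y) (1, 0) := by
    filter_upwards [hU.mem_nhds hy₀] with y hy using hVeq y hy
  have hslice (u : E) : HasDerivWithinAt (fun s ↦ fderiv ℝ (fun z ↦ F (s, z)) y₀ u)
      (fderiv ℝ V y₀ u) K 0 := by
    rw [hVev.fderiv_eq]
    refine (hasDerivWithinAt_fderivWithin_slice hK hK' h0 hU hF hy₀ u).congr_of_mem
      (fun s hs ↦ ?_) h0
    rw [(hasFDerivAt_slice hU hF hs hy₀).fderiv]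
    simp
  have hid (u : E) : fderiv ℝ (fun z ↦ F (0, z)) y₀ u = u := by
    have : (fun z ↦ F (0, z)) =ᶠ[𝓝 y₀] id := by
      filter_upwards [hU.mem_nhds hy₀] with y hy using hF0 y hy
    rw [this.fderiv_eq]
    simp
  have hF₀ : F (0, y₀) = y₀ := hF0 y₀ hy₀
  have hG' : HasFDerivAt G (fderiv ℝ G y₀) (F (0, y₀)) := by
    rw [hF₀]; exact hG.hasFDerivAt
  have h1 := hG'.comp_hasDerivWithinAt (0 : ℝ) (hV y₀ hy₀)
  have h2 := (b.hasFDerivAt.comp_hasDerivWithinAt (0 : ℝ) h1).clm_apply (hslice (Y y₀))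
  have h3 := (c.hasFDerivAt.comp_hasDerivWithinAt (0 : ℝ) h2).clm_apply (hslice (Z y₀))
  have k1 := (b.hasFDerivAt.comp y₀ hG.hasFDerivAt).clm_apply hY.hasFDerivAt
  have k2 : HasFDerivAt (fun y ↦ c (b (G y) (Y y)) (Z y)) _ y₀ :=
    (c.hasFDerivAt.comp y₀ k1).clm_apply hZ.hasFDerivAt
  -- Since `[V, Y] = DY(V) - DV(Y)`, the derivatives of `Y` and `Z` cancel on the Lie derivative
  -- side; the terms with `DG(V)`, `DV(Y)` and `DV(Z)` remain, as in the product rule.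
  refine h3.congr_deriv ?_
  rw [k2.fderiv]
  simp only [Function.comp_apply, hF₀, hid, VectorField.lieBracket, map_add, map_sub,
    add_apply, ContinuousLinearMap.comp_apply,
    ContinuousLinearMap.flip_apply, sub_apply]
  abel

end CoordinateDeformation

/-! ### Lie brackets, Lie derivatives and deformations read in a chart -/

noncomputable section

namespace GeometricFlow

section FirstVariation

open Set

variable {E : Type*} [NormedAddCommGroup E] [NormedSpace ℝ E]
  {M : Type*} [TopologicalSpace M] [ChartedSpace E M]

theorem chartField_self (Y : ∀ x : M, TangentSpace 𝓘(ℝ, E) x) (x : M) :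
    chartField x Y (extChartAt 𝓘(ℝ, E) x x) = chartDeriv x x (Y x) := by
  simp only [chartField]
  rw [extChartAt_to_inv]

variable [IsManifold 𝓘(ℝ, E) ∞ M]

theorem mdifferentiableAt_extChartAt_symm {x₀ : M} {y : E}
    (hy : y ∈ (extChartAt 𝓘(ℝ, E) x₀).target) :
    MDifferentiableAt 𝓘(ℝ, E) 𝓘(ℝ, E) (extChartAt 𝓘(ℝ, E) x₀).symm y := by
  simpa [mdifferentiableWithinAt_univ] using
    mdifferentiableWithinAt_extChartAt_symm (I := 𝓘(ℝ, E)) hy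

theorem mpullbackWithin_extChartAt_symm {x₀ : M} {y : E}
    (hy : y ∈ (extChartAt 𝓘(ℝ, E) x₀).target) (X : ∀ x : M, TangentSpace 𝓘(ℝ, E) x) :
    VectorField.mpullbackWithin 𝓘(ℝ, E) 𝓘(ℝ, E) (extChartAt 𝓘(ℝ, E) x₀).symm X (range 𝓘(ℝ, E)) y =
      chartField x₀ X y := by
  have h := ContinuousLinearMap.inverse_eq
    (mfderivWithin_extChartAt_symm_comp_mfderiv_extChartAt (I := 𝓘(ℝ, E)) hy)
    (mfderiv_extChartAt_comp_mfderivWithin_extChartAt_symm (I := 𝓘(ℝ, E)) hy)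
  rw [VectorField.mpullbackWithin_apply, h]
  rfl

/-- The Lie bracket of vector fields read in a chart. -/
theorem chartDeriv_mlieBracket (X Y : ∀ x : M, TangentSpace 𝓘(ℝ, E) x) (x : M) :
    chartDeriv x x (VectorField.mlieBracket 𝓘(ℝ, E) X Y x) =
      VectorField.lieBracket ℝ (chartField x X) (chartField x Y) (extChartAt 𝓘(ℝ, E) x x) := by
  have hev (X : ∀ x : M, TangentSpace 𝓘(ℝ, E) x) :
      VectorField.mpullbackWithin 𝓘(ℝ, E) 𝓘(ℝ, E) (extChartAt 𝓘(ℝ, E) x).symm X (range 𝓘(ℝ, E))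
        =ᶠ[𝓝 (extChartAt 𝓘(ℝ, E) x x)] chartField x X := by
    filter_upwards [extChartAt_target_mem_nhds (I := 𝓘(ℝ, E)) x] with y hy
    exact mpullbackWithin_extChartAt_symm hy X
  have hset : (extChartAt 𝓘(ℝ, E) x).symm ⁻¹' univ ∩ range 𝓘(ℝ, E) = univ := by simp
  have hbr : VectorField.lieBracketWithin ℝ
      (VectorField.mpullbackWithin 𝓘(ℝ, E) 𝓘(ℝ, E) (extChartAt 𝓘(ℝ, E) x).symm X (range 𝓘(ℝ, E)))
      (VectorField.mpullbackWithin 𝓘(ℝ, E) 𝓘(ℝ, E) (extChartAt 𝓘(ℝ, E) x).symm Y (range 𝓘(ℝ, E)))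
      ((extChartAt 𝓘(ℝ, E) x).symm ⁻¹' univ ∩ range 𝓘(ℝ, E)) (extChartAt 𝓘(ℝ, E) x x) =
      VectorField.lieBracket ℝ (chartField x X) (chartField x Y) (extChartAt 𝓘(ℝ, E) x x) := by
    rw [hset]
    exact (congrFun VectorField.lieBracketWithin_univ _).trans
      ((hev X).lieBracket_vectorField_eq (hev Y))
  have hinv := isInvertible_mfderiv_extChartAt (I := 𝓘(ℝ, E)) (mem_extChartAt_source x)
  exact (hinv.self_apply_inverse _).trans hbr

theorem apply_eq_inCoords_chartField (g : SymTensor E M) {x₀ q : M}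
    (hq : q ∈ (extChartAt 𝓘(ℝ, E) x₀).source) (Y Z : ∀ x : M, TangentSpace 𝓘(ℝ, E) x) :
    g.toFun q (Y q) (Z q) = inCoords x₀ g.toFun ((extChartAt 𝓘(ℝ, E) x₀).symm
        (extChartAt 𝓘(ℝ, E) x₀ q)) (chartField x₀ Y (extChartAt 𝓘(ℝ, E) x₀ q))
        (chartField x₀ Z (extChartAt 𝓘(ℝ, E) x₀ q)) := by
  simp only [chartField]
  rw [(extChartAt 𝓘(ℝ, E) x₀).left_inv hq]
  exact apply_eq_inCoords (by simpa using hq) _ _ _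

theorem differentiableAt_comp_extChartAt_symm {P : Type*} [NormedAddCommGroup P] [NormedSpace ℝ P]
    {f : M → P} {x : M} (hf : ContMDiffAt 𝓘(ℝ, E) 𝓘(ℝ, P) ∞ f x) :
    DifferentiableAt ℝ (fun y ↦ f ((extChartAt 𝓘(ℝ, E) x).symm y)) (extChartAt 𝓘(ℝ, E) x x) := by
  have h : MDifferentiableAt 𝓘(ℝ, E) 𝓘(ℝ, P) f
      ((extChartAt 𝓘(ℝ, E) x).symm (extChartAt 𝓘(ℝ, E) x x)) := by
    rw [extChartAt_to_inv]
    exact hf.mdifferentiableAt (by simp)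
  rw [← mdifferentiableAt_iff_differentiableAt]
  exact h.comp _ (mdifferentiableAt_extChartAt_symm (mem_extChartAt_target x))

theorem mvfderiv_eq_of_eventuallyEq_comp {f : M → ℝ} {x : M} {h : E → ℝ}
    (hh : DifferentiableAt ℝ h (extChartAt 𝓘(ℝ, E) x x))
    (hf : f =ᶠ[𝓝 x] fun q ↦ h (extChartAt 𝓘(ℝ, E) x q)) (v : TangentSpace 𝓘(ℝ, E) x) :
    mvfderiv 𝓘(ℝ, E) f x v = fderiv ℝ h (extChartAt 𝓘(ℝ, E) x x) (chartDeriv x x v) := by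
  have h1 : HasMFDerivAt 𝓘(ℝ, E) 𝓘(ℝ, ℝ) (fun q ↦ h (extChartAt 𝓘(ℝ, E) x q)) x
      (fderiv ℝ h (extChartAt 𝓘(ℝ, E) x x) ∘L chartDeriv x x) :=
    HasMFDerivAt.comp x hh.hasFDerivAt.hasMFDerivAt
      (mdifferentiableAt_extChartAt (I := 𝓘(ℝ, E)) (mem_chart_source E x)).hasMFDerivAt
  have h2 := (h1.congr_of_eventuallyEq hf).mfderiv
  exact DFunLike.congr_fun h2 v

/-- The Lie derivative read in a chart. -/
theorem lieDerivative_eq_chart {X Y Z : ∀ x : M, TangentSpace 𝓘(ℝ, E) x} (g : SymTensor E M)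
    {x : M}
    (hd : DifferentiableAt ℝ (fun y ↦ inCoords x g.toFun ((extChartAt 𝓘(ℝ, E) x).symm y)
      (chartField x Y y) (chartField x Z y)) (extChartAt 𝓘(ℝ, E) x x)) :
    lieDerivative X g Y Z x =
      fderiv ℝ (fun y ↦ inCoords x g.toFun ((extChartAt 𝓘(ℝ, E) x).symm y)
        (chartField x Y y) (chartField x Z y)) (extChartAt 𝓘(ℝ, E) x x)
        (chartField x X (extChartAt 𝓘(ℝ, E) x x))
      - inCoords x g.toFun ((extChartAt 𝓘(ℝ, E) x).symm (extChartAt 𝓘(ℝ, E) x x))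
          (VectorField.lieBracket ℝ (chartField x X) (chartField x Y) (extChartAt 𝓘(ℝ, E) x x))
          (chartField x Z (extChartAt 𝓘(ℝ, E) x x))
      - inCoords x g.toFun ((extChartAt 𝓘(ℝ, E) x).symm (extChartAt 𝓘(ℝ, E) x x))
          (chartField x Y (extChartAt 𝓘(ℝ, E) x x))
          (VectorField.lieBracket ℝ (chartField x X) (chartField x Z)
            (extChartAt 𝓘(ℝ, E) x x)) := by
  have hfun : (fun q ↦ g.toFun q (Y q) (Z q)) =ᶠ[𝓝 x] fun q ↦
      (fun y ↦ inCoords x g.toFun ((extChartAt 𝓘(ℝ, E) x).symm y)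
        (chartField x Y y) (chartField x Z y)) (extChartAt 𝓘(ℝ, E) x q) := by
    filter_upwards [extChartAt_source_mem_nhds (I := 𝓘(ℝ, E)) x] with q hq
    exact apply_eq_inCoords_chartField g hq Y Z
  rw [lieDerivative, mvfderiv_eq_of_eventuallyEq_comp hd hfun, ← chartDeriv_mlieBracket,
    ← chartDeriv_mlieBracket, chartField_self, chartField_self, chartField_self, extChartAt_to_inv,
    ← apply_eq_inCoords (mem_chart_source E x), ← apply_eq_inCoords (mem_chart_source E x)]

/-- A chart around `x` in which a deformation `Φ` of the identity is smooth for small times. -/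
theorem exists_chart_deformation {J : Set ℝ} (hJ : J.OrdConnected) (hJ' : J.Nontrivial)
    (h0 : (0 : ℝ) ∈ J) {Φ : ℝ → M → M}
    (hΦ : ContMDiffOn (𝓘(ℝ, ℝ).prod 𝓘(ℝ, E)) 𝓘(ℝ, E) ∞ (fun p : ℝ × M ↦ Φ p.1 p.2) (J ×ˢ univ))
    (hid : ∀ x, Φ 0 x = x) (x : M) :
    ∃ (K : Set ℝ) (U : Set E), K ∈ 𝓝[J] 0 ∧ K ⊆ J ∧ K.OrdConnected ∧ K.Nontrivial ∧ (0 : ℝ) ∈ K ∧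
      IsOpen U ∧ extChartAt 𝓘(ℝ, E) x x ∈ U ∧ U ⊆ (extChartAt 𝓘(ℝ, E) x).target ∧
      (∀ s ∈ K, ∀ y ∈ U, Φ s ((extChartAt 𝓘(ℝ, E) x).symm y) ∈ (extChartAt 𝓘(ℝ, E) x).source) ∧
      ContDiffOn ℝ ∞ (fun p : ℝ × E ↦ extChartAt 𝓘(ℝ, E) x
        (Φ p.1 ((extChartAt 𝓘(ℝ, E) x).symm p.2))) (K ×ˢ U) := by
  set e := extChartAt 𝓘(ℝ, E) x
  have hin : ContMDiffOn 𝓘(ℝ, ℝ × E) (𝓘(ℝ, ℝ).prod 𝓘(ℝ, E)) ∞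
      (fun p : ℝ × E ↦ (p.1, e.symm p.2)) (J ×ˢ e.target) :=
    contDiff_fst.contMDiff.contMDiffOn.prodMk
      ((contMDiffOn_extChartAt_symm x).comp contDiff_snd.contMDiff.contMDiffOn fun p hp ↦ hp.2)
  have hcomp : ContMDiffOn 𝓘(ℝ, ℝ × E) 𝓘(ℝ, E) ∞
      (fun p : ℝ × E ↦ Φ p.1 (e.symm p.2)) (J ×ˢ e.target) :=
    hΦ.comp hin fun p hp ↦ ⟨hp.1, mem_univ _⟩
  have hmem : ((0 : ℝ), e x) ∈ J ×ˢ e.target := ⟨h0, mem_extChartAt_target x⟩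
  have hev : ∀ᶠ p in 𝓝[J ×ˢ e.target] ((0 : ℝ), e x), Φ p.1 (e.symm p.2) ∈ e.source := by
    refine (hcomp.continuousOn _ hmem).eventually ?_
    simp only [hid]
    rw [extChartAt_to_inv]
    exact extChartAt_source_mem_nhds x
  rw [nhdsWithin_prod_eq, (isOpen_extChartAt_target x).nhdsWithin_eq (mem_extChartAt_target x)]
    at hev
  obtain ⟨A, hA, B, hB, hAB⟩ := Filter.eventually_prod_iff.1 hev
  obtain ⟨ε, hε, hεA⟩ := Metric.mem_nhdsWithin_iff.1 hA
  obtain ⟨U, hUsub, hUo, hxU⟩ := mem_nhds_iff.1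
    (Filter.inter_mem hB ((isOpen_extChartAt_target x).mem_nhds (mem_extChartAt_target x)))
  have hKs : ∀ s ∈ Metric.ball (0 : ℝ) ε ∩ J, ∀ y ∈ U, Φ s (e.symm y) ∈ e.source :=
    fun s hs y hy ↦ hAB (hεA hs) (hUsub hy).1
  refine ⟨Metric.ball 0 ε ∩ J, U, Filter.inter_mem
    (mem_nhdsWithin_of_mem_nhds (Metric.ball_mem_nhds 0 hε)) self_mem_nhdsWithin,
    inter_subset_right, ?_, ?_,
    ⟨Metric.mem_ball_self hε, h0⟩, hUo, hxU, fun y hy ↦ (hUsub hy).2, hKs, ?_⟩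
  · rw [Real.ball_eq_Ioo]
    exact ordConnected_Ioo.inter hJ
  · obtain ⟨a, ha, ha0⟩ := accPt_iff_nhds.1 (hJ.uniqueDiffOn_of_nontrivial hJ' 0 h0).accPt _
      (Metric.ball_mem_nhds 0 hε)
    exact ⟨a, ha, 0, ⟨Metric.mem_ball_self hε, h0⟩, ha0⟩
  · rw [← contMDiffOn_iff_contDiffOn]
    exact contMDiffOn_extChartAt.comp
      (hcomp.mono (prod_mono inter_subset_right fun y hy ↦ (hUsub hy).2))
      fun p hp ↦ by
        rw [← extChartAt_source 𝓘(ℝ, E)]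
        exact hKs p.1 hp.1 p.2 hp.2

end FirstVariation

end GeometricFlow
end

/-! ### First variation along a deformation of the identity -/

noncomputable section

namespace GeometricFlow

section Deformation

open Set

variable {E : Type*} [NormedAddCommGroup E] [NormedSpace ℝ E]
  {M : Type*} [TopologicalSpace M] [ChartedSpace E M]

/-- `Φ` is a smooth deformation of the identity, over the interval `J`, with initial velocity
`X`. -/
structure IsDeformation (J : Set ℝ) (Φ : ℝ → M → M) (X : ∀ x : M, TangentSpace 𝓘(ℝ, E) x) :
    Prop where
  ordConnected : J.OrdConnected
  nontrivial : J.Nontrivial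
  zero_mem : (0 : ℝ) ∈ J
  contMDiffOn : ContMDiffOn (𝓘(ℝ, ℝ).prod 𝓘(ℝ, E)) 𝓘(ℝ, E) ∞ (fun p : ℝ × M ↦ Φ p.1 p.2)
    (J ×ˢ univ)
  zero : ∀ x, Φ 0 x = x
  velocity : ∀ x₀ x, x ∈ (extChartAt 𝓘(ℝ, E) x₀).source →
    HasDerivWithinAt (fun t ↦ extChartAt 𝓘(ℝ, E) x₀ (Φ t x)) (chartDeriv x₀ x (X x)) J 0

variable {J : Set ℝ} {Φ : ℝ → M → M} {X : ∀ x : M, TangentSpace 𝓘(ℝ, E) x}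

theorem IsDeformation.hasDerivWithinAt_chart (h : IsDeformation J Φ X) {x : M} {y : E}
    (hy : y ∈ (extChartAt 𝓘(ℝ, E) x).target) {K : Set ℝ} (hK : K ⊆ J) :
    HasDerivWithinAt (fun s ↦ extChartAt 𝓘(ℝ, E) x (Φ s ((extChartAt 𝓘(ℝ, E) x).symm y)))
      (chartField x X y) K 0 :=
  (h.velocity x _ ((extChartAt 𝓘(ℝ, E) x).map_target hy)).mono hK

theorem IsDeformation.contMDiff_apply (h : IsDeformation J Φ X) {s : ℝ} (hs : s ∈ J) :
    ContMDiff 𝓘(ℝ, E) 𝓘(ℝ, E) ∞ (Φ s) := by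
  rw [← contMDiffOn_univ]
  exact h.contMDiffOn.comp (f := fun q : M ↦ (s, q))
    (contMDiff_const.prodMk contMDiff_id).contMDiffOn fun q _ ↦ ⟨hs, mem_univ _⟩

variable [IsManifold 𝓘(ℝ, E) ∞ M]

/-- The velocity is prescribed only pointwise, but one-sided derivatives on an interval are unique,
so in a chart `X` is the time derivative of a jointly smooth map. -/
theorem IsDeformation.contMDiff (h : IsDeformation J Φ X) :
    ContMDiff 𝓘(ℝ, E) 𝓘(ℝ, E).tangent ∞ (fun x ↦ (⟨x, X x⟩ : TangentBundle 𝓘(ℝ, E) M)) := by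
  intro x
  obtain ⟨K, U, -, hKJ, hK, hK', h0, hU, hxU, hUt, -, hF⟩ :=
    exists_chart_deformation h.ordConnected h.nontrivial h.zero_mem h.contMDiffOn h.zero x
  refine contMDiffAt_of_contDiffAt_chartField ?_
  refine ((contDiffOn_velocity hK hK' h0 hU hF).contDiffAt
    (hU.mem_nhds hxU)).congr_of_eventuallyEq ?_
  filter_upwards [hU.mem_nhds hxU] with y hy
  exact (hK.uniqueDiffOn_of_nontrivial hK' 0 h0).eq_deriv _
    (h.hasDerivWithinAt_chart (hUt hy) hKJ) (hasDerivWithinAt_slice hF h0 hy)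

theorem IsDeformation.chartDeriv_mfderiv (h : IsDeformation J Φ X) {s : ℝ} (hs : s ∈ J) {x : M}
    (hsx : Φ s x ∈ (extChartAt 𝓘(ℝ, E) x).source)
    (hd : DifferentiableAt ℝ (fun y ↦ extChartAt 𝓘(ℝ, E) x
      (Φ s ((extChartAt 𝓘(ℝ, E) x).symm y))) (extChartAt 𝓘(ℝ, E) x x))
    (v : TangentSpace 𝓘(ℝ, E) x) :
    chartDeriv x (Φ s x) (mfderiv 𝓘(ℝ, E) 𝓘(ℝ, E) (Φ s) x v) =
      fderiv ℝ (fun y ↦ extChartAt 𝓘(ℝ, E) x (Φ s ((extChartAt 𝓘(ℝ, E) x).symm y)))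
        (extChartAt 𝓘(ℝ, E) x x) (chartDeriv x x v) := by
  have h1 := (mdifferentiableAt_extChartAt (I := 𝓘(ℝ, E)) (x := x) (y := Φ s x)
    (by simpa using hsx)).hasMFDerivAt.comp x
    ((h.contMDiff_apply hs).mdifferentiableAt (by simp) (x := x)).hasMFDerivAt
  have h2 : HasMFDerivAt 𝓘(ℝ, E) 𝓘(ℝ, E) ((fun y ↦ extChartAt 𝓘(ℝ, E) x
      (Φ s ((extChartAt 𝓘(ℝ, E) x).symm y))) ∘ extChartAt 𝓘(ℝ, E) x) x _ :=
    HasMFDerivAt.comp x hd.hasFDerivAt.hasMFDerivAt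
      (mdifferentiableAt_extChartAt (I := 𝓘(ℝ, E)) (mem_chart_source E x)).hasMFDerivAt
  have h3 : extChartAt 𝓘(ℝ, E) x ∘ Φ s =ᶠ[𝓝 x] (fun y ↦ extChartAt 𝓘(ℝ, E) x
      (Φ s ((extChartAt 𝓘(ℝ, E) x).symm y))) ∘ extChartAt 𝓘(ℝ, E) x := by
    filter_upwards [extChartAt_source_mem_nhds (I := 𝓘(ℝ, E)) x] with q hq
    simp only [Function.comp_apply]
    rw [(extChartAt 𝓘(ℝ, E) x).left_inv hq]
  exact DFunLike.congr_fun (hasMFDerivAt_unique h1 (h2.congr_of_eventuallyEq h3)) v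

set_option synthInstance.maxHeartbeats 400000 in
/-- The first variation of the pull-back of a symmetric tensor field along a deformation of the
identity is its Lie derivative along the initial velocity. -/
theorem IsDeformation.hasDerivWithinAt_pullbackAt (h : IsDeformation J Φ X) (g : SymTensor E M)
    {x : M} {Y Z : ∀ x : M, TangentSpace 𝓘(ℝ, E) x}
    (hY : ContMDiffAt 𝓘(ℝ, E) 𝓘(ℝ, E).tangent ∞
      (fun y ↦ (⟨y, Y y⟩ : TangentBundle 𝓘(ℝ, E) M)) x)
    (hZ : ContMDiffAt 𝓘(ℝ, E) 𝓘(ℝ, E).tangent ∞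
      (fun y ↦ (⟨y, Z y⟩ : TangentBundle 𝓘(ℝ, E) M)) x) :
    HasDerivWithinAt (fun s ↦ SymTensor.pullbackAt (Φ s) g x (Y x) (Z x))
      (lieDerivative X g Y Z x) J 0 := by
  obtain ⟨K, U, hKn, hKJ, hK, hK', h0, hU, hxU, hUt, hsrc, hF⟩ :=
    exists_chart_deformation h.ordConnected h.nontrivial h.zero_mem h.contMDiffOn h.zero x
  have hfield {Y : ∀ x : M, TangentSpace 𝓘(ℝ, E) x} (hY : ContMDiffAt 𝓘(ℝ, E) 𝓘(ℝ, E).tangent ∞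
      (fun y ↦ (⟨y, Y y⟩ : TangentBundle 𝓘(ℝ, E) M)) x) :
      DifferentiableAt ℝ (chartField x Y) (extChartAt 𝓘(ℝ, E) x x) :=
    (contDiffAt_chartField le_rfl (mem_extChartAt_target x)
      (by rwa [extChartAt_to_inv])).differentiableAt (by simp)
  have hG := differentiableAt_comp_extChartAt_symm
    ((contMDiffAt_iff_inCoords _ x).1 (g.contMDiff x))
  have hvar := hasDerivWithinAt_pullback_coord (.id ℝ (E →L[ℝ] E →L[ℝ] ℝ)) (.id ℝ (E →L[ℝ] ℝ))
    hK hK' h0 hU hF hxU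
    (fun y hy ↦ by simp only [h.zero]; exact (extChartAt 𝓘(ℝ, E) x).right_inv (hUt hy)) hG
    (fun y hy ↦ h.hasDerivWithinAt_chart (hUt hy) hKJ) (hfield hY) (hfield hZ)
  rw [lieDerivative_eq_chart g (differentiableAt_pairing (.id ℝ (E →L[ℝ] E →L[ℝ] ℝ))
    (.id ℝ (E →L[ℝ] ℝ)) hG (hfield hY) (hfield hZ))]
  -- The coordinate formula is valid on the smaller interval `K`, which is a neighbourhood of `0`
  -- within `J`.
  refine (hvar.congr_of_mem (fun s hs ↦ ?_) h0).mono_of_mem_nhdsWithin hKn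
  have hsx : Φ s x ∈ (extChartAt 𝓘(ℝ, E) x).source := by
    simpa only [extChartAt_to_inv] using hsrc s hs _ hxU
  have hd := (hasFDerivAt_slice hU hF hs hxU).differentiableAt
  rw [SymTensor.pullbackAt_apply, apply_eq_inCoords (x₀ := x) (by simpa using hsx),
    h.chartDeriv_mfderiv (hKJ hs) hsx hd, h.chartDeriv_mfderiv (hKJ hs) hsx hd,
    ← chartField_self, ← chartField_self]
  simp only [extChartAt_to_inv]
  rw [(extChartAt 𝓘(ℝ, E) x).left_inv hsx]
  rfl

end Deformation

end GeometricFlow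
end

/-! ### Solitons and self-similar solutions -/

noncomputable section

namespace GeometricFlow

section Solitons

open Set

variable {E : Type*} [NormedAddCommGroup E] [NormedSpace ℝ E]
  {M : Type*} [TopologicalSpace M] [ChartedSpace E M] [IsManifold 𝓘(ℝ, E) ∞ M]

theorem SymTensor.ext_apply {g h : SymTensor E M}
    (H : ∀ (x : M) (v w : TangentSpace 𝓘(ℝ, E) x), g.toFun x v w = h.toFun x v w) : g = h := by
  cases g
  cases h
  congr
  funext x
  ext v w
  exact H x v w

theorem SymTensor.smul_apply (a : ℝ) (h : SymTensor E M) (x : M)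
    (v w : TangentSpace 𝓘(ℝ, E) x) : (a • h).toFun x v w = a * h.toFun x v w := rfl

theorem SymTensor.one_smul (h : SymTensor E M) : (1 : ℝ) • h = h :=
  SymTensor.ext_apply fun x v w ↦ by rw [SymTensor.smul_apply, one_mul]

theorem SymTensor.pullback_smul (φ : M ≃ₘ^∞⟮𝓘(ℝ, E), 𝓘(ℝ, E)⟯ M) (a : ℝ) (h : SymTensor E M) :
    SymTensor.pullback φ (a • h) = a • SymTensor.pullback φ h := rfl

theorem SymTensor.pullbackAt_id (h : SymTensor E M) (x : M) (v w : TangentSpace 𝓘(ℝ, E) x) :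
    SymTensor.pullbackAt id h x v w = h.toFun x v w := by
  rw [SymTensor.pullbackAt_apply, mfderiv_id]
  rfl

theorem SymTensor.pullback_refl (h : SymTensor E M) :
    SymTensor.pullback (Diffeomorph.refl 𝓘(ℝ, E) M ∞) h = h :=
  SymTensor.ext_apply fun x v w ↦ SymTensor.pullbackAt_id h x v w

theorem SymTensor.pullbackAt_comp {φ ψ : M → M} {x : M}
    (hφ : MDifferentiableAt 𝓘(ℝ, E) 𝓘(ℝ, E) φ (ψ x))
    (hψ : MDifferentiableAt 𝓘(ℝ, E) 𝓘(ℝ, E) ψ x) (h : SymTensor E M)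
    (v w : TangentSpace 𝓘(ℝ, E) x) :
    SymTensor.pullbackAt (φ ∘ ψ) h x v w = SymTensor.pullbackAt φ h (ψ x)
      (mfderiv 𝓘(ℝ, E) 𝓘(ℝ, E) ψ x v) (mfderiv 𝓘(ℝ, E) 𝓘(ℝ, E) ψ x w) := by
  rw [SymTensor.pullbackAt_apply, mfderiv_comp x hφ hψ]
  rfl

theorem SymTensor.IsRiemannianMetric.smul {g : SymTensor E M} (hg : g.IsRiemannianMetric) {a : ℝ}
    (ha : 0 < a) : (a • g).IsRiemannianMetric :=
  fun x v hv ↦ mul_pos ha (hg x v hv)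

theorem hasDerivWithinAt_extChartAt_comp {γ : ℝ → M} {J : Set ℝ} {t : ℝ} {x₀ x : M} {v : E}
    (hx : γ t = x) (hs : x ∈ (extChartAt 𝓘(ℝ, E) x₀).source)
    {A : ℝ →L[ℝ] TangentSpace 𝓘(ℝ, E) (γ t)}
    (hγ : HasMFDerivWithinAt 𝓘(ℝ, ℝ) 𝓘(ℝ, E) γ J t A) (hv : A 1 = v) :
    HasDerivWithinAt (fun s ↦ extChartAt 𝓘(ℝ, E) x₀ (γ s)) (chartDeriv x₀ x v) J t := by
  subst hx hv
  have h := (mdifferentiableAt_extChartAt (I := 𝓘(ℝ, E)) (x := x₀) (y := γ t)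
    (by simpa using hs)).hasMFDerivAt.comp_hasMFDerivWithinAt t hγ
  have h' : HasFDerivWithinAt (fun s ↦ extChartAt 𝓘(ℝ, E) x₀ (γ s))
      (chartDeriv x₀ (γ t) ∘L A : ℝ →L[ℝ] E) J t := h.hasFDerivWithinAt
  exact h'.hasDerivWithinAt

/-- The Lie derivative is tested on vector fields while the evolution equation is tested on tangent
vectors; extensions pass from one to the other. -/
theorem exists_contMDiffAt_extension (x : M) (v : TangentSpace 𝓘(ℝ, E) x) :
    ∃ Y : ∀ x : M, TangentSpace 𝓘(ℝ, E) x, Y x = v ∧ ContMDiffAt 𝓘(ℝ, E) 𝓘(ℝ, E).tangent ∞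
      (fun y ↦ (⟨y, Y y⟩ : TangentBundle 𝓘(ℝ, E) M)) x :=
  ⟨FiberBundle.extend E v, FiberBundle.extend_apply_self E v,
    FiberBundle.contMDiffAt_extend 𝓘(ℝ, E) E v⟩

variable {T : SymTensor E M → SymTensor E M} {g₀ : SymTensor E M}

theorem IsSelfSimilarSolution.exists_isDeformation {J : Set ℝ} {c : ℝ → ℝ}
    {φ : ℝ → M ≃ₘ^∞⟮𝓘(ℝ, E), 𝓘(ℝ, E)⟯ M} (h : IsSelfSimilarSolution T g₀ J c φ) :
    ∃ X : ∀ x : M, TangentSpace 𝓘(ℝ, E) x, IsDeformation J (fun t ↦ φ t) X := by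
  have hzero (x : M) : φ 0 x = x := by
    rw [h.diffeo_zero]
    rfl
  refine ⟨fun x ↦ (mfderivWithin 𝓘(ℝ, ℝ) 𝓘(ℝ, E) (fun t ↦ φ t x) J 0 (1 : ℝ) : E),
    h.ordConnected, h.nontrivial, h.zero_mem, h.diffeo_smooth, hzero, fun x₀ x hx ↦ ?_⟩
  have hcurve : ContMDiffOn 𝓘(ℝ, ℝ) 𝓘(ℝ, E) ∞ (fun t ↦ φ t x) J :=
    h.diffeo_smooth.comp (f := fun t : ℝ ↦ (t, x)) (contMDiff_id.prodMk contMDiff_const).contMDiffOn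
      fun t ht ↦ ⟨ht, mem_univ _⟩
  exact hasDerivWithinAt_extChartAt_comp (hzero x) hx
    ((hcurve 0 h.zero_mem).mdifferentiableWithinAt (by simp)).hasMFDerivWithinAt rfl

theorem IsSelfSimilarSolution.isSoliton {J : Set ℝ} {c : ℝ → ℝ}
    {φ : ℝ → M ≃ₘ^∞⟮𝓘(ℝ, E), 𝓘(ℝ, E)⟯ M} (h : IsSelfSimilarSolution T g₀ J c φ)
    (hg₀ : g₀.IsRiemannianMetric) : IsSoliton T g₀ := by
  obtain ⟨X, hX⟩ := h.exists_isDeformation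
  have huniq := h.ordConnected.uniqueDiffOn_of_nontrivial h.nontrivial 0 h.zero_mem
  have hzero (x : M) (v w : TangentSpace 𝓘(ℝ, E) x) :
      SymTensor.pullbackAt (φ 0) g₀ x v w = g₀.toFun x v w := by
    rw [h.diffeo_zero]
    exact SymTensor.pullbackAt_id g₀ x v w
  have hev (x : M) (v w : TangentSpace 𝓘(ℝ, E) x) :
      HasDerivWithinAt (fun s ↦ c s * SymTensor.pullbackAt (φ s) g₀ x v w)
        ((T g₀).toFun x v w) J 0 := by
    have := h.evolution 0 h.zero_mem x v w
    rwa [h.scale_zero, h.diffeo_zero, SymTensor.one_smul, SymTensor.pullback_refl] at this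
  by_cases hv : ∃ (x : M) (v : TangentSpace 𝓘(ℝ, E) x), v ≠ 0
  · obtain ⟨x, v, hv⟩ := hv
    obtain ⟨Y, rfl, hY⟩ := exists_contMDiffAt_extension x v
    have hd := hX.hasDerivWithinAt_pullbackAt g₀ hY hY
    have hpos : SymTensor.pullbackAt (φ 0) g₀ x (Y x) (Y x) ≠ 0 := by
      rw [hzero]
      exact (hg₀ x _ hv).ne'
    have hne : ∀ᶠ s in 𝓝[J] 0, SymTensor.pullbackAt (φ s) g₀ x (Y x) (Y x) ≠ 0 :=
      hd.continuousWithinAt.eventually_ne hpos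
    -- Near `0`, `c` is the quotient of two functions that are differentiable at `0`, with nonzero
    -- denominator by positivity of `g₀`.
    obtain ⟨β, hc⟩ : ∃ β, HasDerivWithinAt c β J 0 :=
      ⟨_, ((hev x (Y x) (Y x)).div hd hpos).congr_of_eventuallyEq (f₁ := c)
      (by filter_upwards [hne] with s hs
          exact (mul_div_cancel_right₀ _ hs).symm) (mul_div_cancel_right₀ _ hpos).symm⟩
    refine ⟨X, β, hX.contMDiff, fun x Y Z hY hZ ↦ ?_⟩
    have hd' := hc.mul (hX.hasDerivWithinAt_pullbackAt g₀ hY hZ)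
    have := huniq.eq_deriv _ hd' (hev x (Y x) (Z x))
    rwa [hzero, h.scale_zero, one_mul] at this
  -- Without nonzero tangent vectors there is nothing to divide by, but every bilinear form vanishes
  -- and `β = 0` serves.
  · push Not at hv
    refine ⟨X, 0, hX.contMDiff, fun x Y Z hY hZ ↦ ?_⟩
    have hd := hX.hasDerivWithinAt_pullbackAt g₀ hY hZ
    have h0 (B : TangentSpace 𝓘(ℝ, E) x →L[ℝ] TangentSpace 𝓘(ℝ, E) x →L[ℝ] ℝ) :
        B (Y x) (Z x) = 0 := by
      rw [hv x (Z x), map_zero]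
    simp only [h0] at hd ⊢
    rw [huniq.eq_deriv _ hd (hasDerivWithinAt_const _ _ _), mul_zero, add_zero]

variable [FiniteDimensional ℝ E] [T2Space M]

theorem IsFlow.isDeformation {θ : ℝ → M → M} {X : ∀ x : M, TangentSpace 𝓘(ℝ, E) x}
    (hθ : IsFlow θ X)
    (hX : ContMDiff 𝓘(ℝ, E) 𝓘(ℝ, E).tangent ∞ (fun x ↦ (⟨x, X x⟩ : TangentBundle 𝓘(ℝ, E) M))) :
    IsDeformation univ θ X where
  ordConnected := ordConnected_univ
  nontrivial := nontrivial_univ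
  zero_mem := mem_univ _
  contMDiffOn := (hθ.contMDiff hX).contMDiffOn
  zero := hθ.zero
  velocity x₀ x hx := by
    refine hasDerivWithinAt_extChartAt_comp (hθ.zero x) hx
      (hθ.integralCurve x 0).hasMFDerivWithinAt ?_
    have : (X (θ 0 x) : E) = X x := by rw [hθ.zero]
    exact (_root_.one_smul ℝ (X (θ 0 x) : E)).trans this

/-- The evolution of a soliton metric under the flow of its vector field. -/
theorem IsSolitonStructure.hasDerivAt_pullbackAt {θ : ℝ → M → M}
    {X : ∀ x : M, TangentSpace 𝓘(ℝ, E) x} {β : ℝ} (h : IsSolitonStructure T g₀ X β)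
    (hθ : IsFlow θ X) (t : ℝ) (x : M) (v w : TangentSpace 𝓘(ℝ, E) x) :
    HasDerivAt (fun s ↦ SymTensor.pullbackAt (θ s) g₀ x v w)
      (SymTensor.pullbackAt (θ t) (T g₀) x v w - β * SymTensor.pullbackAt (θ t) g₀ x v w) t := by
  have hdef := hθ.isDeformation h.contMDiff
  have hdiff (s : ℝ) (x : M) : MDifferentiableAt 𝓘(ℝ, E) 𝓘(ℝ, E) (θ s) x :=
    (hdef.contMDiff_apply (mem_univ s)).mdifferentiableAt (by simp)
  obtain ⟨Y, hYv, hY⟩ := exists_contMDiffAt_extension (θ t x) (mfderiv 𝓘(ℝ, E) 𝓘(ℝ, E) (θ t) x v)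
  obtain ⟨Z, hZw, hZ⟩ := exists_contMDiffAt_extension (θ t x) (mfderiv 𝓘(ℝ, E) 𝓘(ℝ, E) (θ t) x w)
  have hd := hdef.hasDerivWithinAt_pullbackAt g₀ hY hZ
  -- The formula at time `0` and point `θ t x` is moved to time `t` through `θ s = θ (s - t) ∘ θ t`;
  -- hence `0` is written as `t - t`.
  rw [hasDerivWithinAt_univ, eq_sub_of_add_eq' (h.equation _ Y Z hY hZ), hYv, hZw,
    ← sub_self t] at hd
  have hshift := hd.comp_sub_const t t
  refine hshift.congr_of_eventuallyEq (.of_forall fun s ↦ ?_)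
  have hs : θ s = θ (s - t) ∘ θ t := by
    funext q
    rw [Function.comp_apply, ← hθ.add h.contMDiff, sub_add_cancel]
  simp only [hs]
  exact SymTensor.pullbackAt_comp (hdiff _ _) (hdiff _ _) g₀ v w

/-- Separation of variables: `exp(a τ)` has derivative `a`, hence equals `1 + a t`, and the solution
lives where this is positive. -/
theorem exists_time_change (a : ℝ) : ∃ (J : Set ℝ) (τ : ℝ → ℝ), IsOpen J ∧ J.OrdConnected ∧
    (0 : ℝ) ∈ J ∧ τ 0 = 0 ∧ ContDiffOn ℝ ∞ τ J ∧
      ∀ t ∈ J, HasDerivAt τ (Real.exp (-(a * τ t))) t := by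
  rcases eq_or_ne a 0 with rfl | ha
  · exact ⟨univ, id, isOpen_univ, ordConnected_univ, mem_univ _, rfl, contDiffOn_id,
      fun t _ ↦ by simpa using hasDerivAt_id t⟩
  have hlin (t : ℝ) : HasDerivAt (fun t ↦ 1 + a * t) a t := by
    simpa using ((hasDerivAt_id t).const_mul a).const_add 1
  refine ⟨{t | 0 < 1 + a * t}, fun t ↦ Real.log (1 + a * t) / a,
    isOpen_lt continuous_const (by fun_prop), ⟨fun s hs t ht r hr ↦ ?_⟩, by simp, by simp, ?_,
    fun t ht ↦ ?_⟩
  · simp only [mem_ofPred_eq] at *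
    rcases le_total 0 a with h | h
    · nlinarith [hr.1]
    · nlinarith [hr.2]
  · exact (ContDiffOn.log (by fun_prop) fun t ht ↦ ht.ne').div_const a
  · refine (((hlin t).log (ne_of_gt ht)).div_const a).congr_deriv ?_
    rw [mul_div_cancel₀ _ ha, Real.exp_neg, Real.exp_log ht]
    field_simp

theorem IsSolitonStructure.exists_isSelfSimilarSolution_of_steady
    {X : ∀ x : M, TangentSpace 𝓘(ℝ, E) x} (h : IsSolitonStructure T g₀ X 0)
    (hX : IsCompleteField X) (hT : IsNatural T) (hg₀ : g₀.IsRiemannianMetric) :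
    ∃ φ : ℝ → M ≃ₘ^∞⟮𝓘(ℝ, E), 𝓘(ℝ, E)⟯ M, IsSelfSimilarSolution T g₀ univ (fun _ ↦ 1) φ := by
  obtain ⟨θ, hθ⟩ := hX.exists_isFlow
  refine ⟨hθ.diffeo h.contMDiff, ordConnected_univ, nontrivial_univ, mem_univ _, rfl,
    fun _ _ ↦ one_pos, Diffeomorph.ext hθ.zero, (hθ.contMDiff h.contMDiff).contMDiffOn,
    fun t _ x v w ↦ ?_⟩
  simp only [SymTensor.one_smul]
  rw [← hT _ _ hg₀]
  have hd := h.hasDerivAt_pullbackAt hθ t x v w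
  rw [zero_mul, sub_zero] at hd
  exact hd.hasDerivWithinAt

theorem IsSolitonStructure.exists_isSelfSimilarSolution_of_isHomogeneous
    {X : ∀ x : M, TangentSpace 𝓘(ℝ, E) x} {β q : ℝ} (h : IsSolitonStructure T g₀ X β)
    (hX : IsCompleteField X) (hT : IsNatural T) (hq : IsHomogeneous T q)
    (hg₀ : g₀.IsRiemannianMetric) :
    ∃ (J : Set ℝ) (c : ℝ → ℝ) (φ : ℝ → M ≃ₘ^∞⟮𝓘(ℝ, E), 𝓘(ℝ, E)⟯ M),
      IsOpen J ∧ ContDiffOn ℝ ∞ c J ∧ IsSelfSimilarSolution T g₀ J c φ := by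
  obtain ⟨θ, hθ⟩ := hX.exists_isFlow
  -- This constant makes `c τ' = c^q` for `c = exp(β τ)`, which is the identity `he` below.
  obtain ⟨J, τ, hJo, hJ, h0, hτ0, hτ, hτ'⟩ := exists_time_change ((1 - q) * β)
  refine ⟨J, fun t ↦ Real.exp (β * τ t), fun t ↦ hθ.diffeo h.contMDiff (τ t), hJo,
    (contDiffOn_const.mul hτ).exp, hJ, ?_, h0, by simp [hτ0], fun t _ ↦ Real.exp_pos _,
    Diffeomorph.ext fun x ↦ ?_, ?_, fun t ht x v w ↦ ?_⟩
  · exact (infinite_of_mem_nhds 0 (hJo.mem_nhds h0)).nontrivial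
  · rw [hτ0]
    exact hθ.zero x
  · exact (hθ.contMDiff h.contMDiff).comp_contMDiffOn (f := fun p : ℝ × M ↦ (τ p.1, p.2))
      ((hτ.contMDiffOn.comp contMDiff_fst.contMDiffOn fun p hp ↦ hp.1).prodMk
        contMDiff_snd.contMDiffOn)
  · have hc := ((hτ' t ht).const_mul β).exp
    have hd := hc.mul ((h.hasDerivAt_pullbackAt hθ (τ t) x v w).comp t (hτ' t ht))
    refine (hd.congr_deriv ?_).hasDerivWithinAt
    rw [← SymTensor.pullback_smul, ← hT _ _ (hg₀.smul (Real.exp_pos _)),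
      hq _ hg₀ _ (Real.exp_pos _), SymTensor.pullback_smul, SymTensor.smul_apply,
      ← Real.exp_mul]
    have he : Real.exp (β * τ t) * Real.exp (-((1 - q) * β * τ t)) =
        Real.exp (β * τ t * q) := by
      rw [← Real.exp_add]
      ring_nf
    rw [← he]
    change _ = _ * SymTensor.pullbackAt (θ (τ t)) (T g₀) x v w
    simp only [Function.comp_apply]
    ring

end Solitons

end GeometricFlow

end

theorem mainTheorem2 {E : Type*} [NormedAddCommGroup E] [NormedSpace ℝ E] [FiniteDimensional ℝ E]
    {M : Type*} [TopologicalSpace M] [T2Space M] [ChartedSpace E M] [IsManifold 𝓘(ℝ, E) ∞ M]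
    (T : GeometricFlow.SymTensor E M → GeometricFlow.SymTensor E M)
    (hT : GeometricFlow.IsNatural T)
    (g₀ : GeometricFlow.SymTensor E M) (hg₀ : g₀.IsRiemannianMetric) :
    (∀ (J : Set ℝ) (c : ℝ → ℝ) (φ : ℝ → M ≃ₘ^∞⟮𝓘(ℝ, E), 𝓘(ℝ, E)⟯ M),
      GeometricFlow.IsSelfSimilarSolution T g₀ J c φ → GeometricFlow.IsSoliton T g₀) ∧
    (∀ X : (∀ x : M, TangentSpace 𝓘(ℝ, E) x),
      GeometricFlow.IsSolitonStructure T g₀ X 0 → GeometricFlow.IsCompleteField X →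
      ∃ φ : ℝ → M ≃ₘ^∞⟮𝓘(ℝ, E), 𝓘(ℝ, E)⟯ M,
        GeometricFlow.IsSelfSimilarSolution T g₀ Set.univ (fun _ ↦ 1) φ) ∧
    (∀ q : ℝ, GeometricFlow.IsHomogeneous T q →
      ∀ (X : ∀ x : M, TangentSpace 𝓘(ℝ, E) x) (β : ℝ),
        GeometricFlow.IsSolitonStructure T g₀ X β → GeometricFlow.IsCompleteField X →
        ∃ (J : Set ℝ) (c : ℝ → ℝ) (φ : ℝ → M ≃ₘ^∞⟮𝓘(ℝ, E), 𝓘(ℝ, E)⟯ M),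
          IsOpen J ∧ ContDiffOn ℝ ∞ c J ∧
            GeometricFlow.IsSelfSimilarSolution T g₀ J c φ) :=
  ⟨fun _ _ _ h ↦ h.isSoliton hg₀,
    fun _ h hX ↦ h.exists_isSelfSimilarSolution_of_steady hX hT hg₀,
    fun _ hq _ _ h hX ↦ h.exists_isSelfSimilarSolution_of_isHomogeneous hX hT hq hg₀⟩
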